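/- Let $\mathcal A$ be a von Neumann algebra with a normal state $\phi$ that is non-degenerated, i.e. $x=0$ whenever $\phi(axb)=0$ for all $a,b\in\mathcal A$. Let $(x_i)_{i\in\mathbb N}$ be a sequence of selfadjoint elements of $\mathcal A$ such that $\mathcal A$ is the closure, in the weak operator topology (WOT), of the non-unital algebra generated by $\{x_i\mid i\in\mathbb N\}$. Let $\mathcal T=\bigcap_{n\ge1}W^*\{x_k\mid k\ge n\}$ be the non-unital tail algebra, where $W^*\{x_k\mid k\ge n\}$ is the WOT closure of the non-unital algebra generated by $\{x_k\mid k\ge n\}$. For $n\in\mathbb N$ let $B_s(n)$ be the universal unital $C^*$-algebra generated by orthogonal projections $u_{i,j}$ $(1\le i,j\le n)$ and $\mathbf P$ subject to $u_{i,k}u_{i,l}=0=u_{k,i}u_{l,i}$ for $k\ne l$ and $\sum_{k=1}^n u_{k,i}\mathbf P=\mathbf P$ for all $i$; put $\mathcal B_s(n)=\mathbf P B_s(n)\mathbf P$, and let $\mathcal L_n:\mathbb C\langle X_1,\dots,X_n\rangle\to\mathbb C\langle X_1,\dots,X_n\rangle\otimes\mathcal B_s(n)$ be the linear map $$\mathcal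 L_n(X_{i_1}\cdots X_{i_k})=\sum_{j_1,\dots,j_k=1}^n X_{j_1}\cdots X_{j_k}\otimes\mathbf P u_{j_1,i_1}\cdots u_{j_k,i_k}\mathbf P .$$ Assume that the joint distribution of $(x_i)$ is invariant under the linear coactions of the $\mathcal B_s(n)$, i.e. for all $n$ and all $p\in\mathbb C\langle X_1,\dots,X_n\rangle$ one has $(\mu_n\otimes\mathrm{id})(\mathcal L_n p)=\mu_n(p)\mathbf P$, where $\mu_n(p)=\phi(p(x_1,\dots,x_n))$. Then there is exactly one normal $\phi$-preserving conditional expectation $E:\mathcal A\to\mathcal T$ onto $\mathcal T$, that is, a normal linear map with values in $\mathcal T$ such that $E[t]=t$, $E[ta]=tE[a]$, $E[at]=E[a]t$ and $\phi(E[a])=\phi(a)$ for all $t\in\mathcal T$, $a\in\mathcal A$. It satisfies $$E[x_{i_1}\cdots x_{i_k}]=\operatorname{WOT-}\lim_{N\to\infty}x_{i_1+N}\cdots x_{i_k+N}\qquad(k\ge1,\ i_1,\dots,i_k\in\mathbb N),$$ and it has the following factorization property. Let $\mathcal T\langle X\rangle_0$ be the set of $\mathcal T$-valued polynomials without constant term,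 i.e. the linear span of the monomials $b_0Xb_1X\cdots Xb_r$ with $r\ge1$ and each $b_j$ in $\mathcal T$ or a scalar. For all $n\ge1$, $p_1,\dots,p_n\in\mathcal T\langle X\rangle_0$, $1\le m\le n$ and all indices $i_1,\dots,i_n\in\mathbb N$ with $i_{m-1}\ne i_m$ (if $m>1$) and $i_m\ne i_{m+1}$ (if $m<n$), $$E[p_1(x_{i_1})\cdots p_m(x_{i_m})\cdots p_n(x_{i_n})]=E[p_1(x_{i_1})\cdots E[p_m(x_{i_m})]\cdots p_n(x_{i_n})].$$ In particular, this holds whenever $i_1\ne i_2\ne\cdots\ne i_n$. -/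

import Mathlib

open scoped ComplexOrder InnerProductSpace TensorProduct ENNReal Topology

noncomputable section

namespace BoolDeFinetti

universe u

/-! ### The universal C*-algebra `B_s(n)` and the boolean permutation quantum semigroup -/

/-- The defining relations of `B_s(n)` for elements `u i j`, `P` of a `*`-algebra: all of them are
orthogonal projections, distinct entries in one row or in one column of `u` are orthogonal, and
`P = ∑ k, u k i * P` for every column `i`. -/
structure BoolRelations {n : ℕ} {C : Type*} [Ring C] [StarRing C]
    (u : Fin n → Fin n → C) (P : C) : Prop where
  proj : ∀ i j, IsStarProjection (u i j)
  proj_P : IsStarProjection P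
  row : ∀ i k l, k ≠ l → u i k * u i l = 0
  col : ∀ i k l, k ≠ l → u k i * u l i = 0
  sum : ∀ i, ∑ k, u k i * P = P

/-- A realization of the defining relations of `B_s(n)` in a (nonzero) unital C*-algebra. -/
structure BoolModel (n : ℕ) where
  C : Type
  [inst : CStarAlgebra C]
  [nontriv : Nontrivial C]
  u : Fin n → Fin n → C
  P : C
  rel : BoolRelations u P

instance (n : ℕ) (m : BoolModel n) : CStarAlgebra m.C := m.inst

instance (n : ℕ) (m : BoolModel n) : Nontrivial m.C := m.nontriv

/-- The C*-algebra of all bounded families `(c_m)`, `c_m ∈ m.C`, indexed by all realizations of the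
relations, with coordinatewise operations and the supremum norm. -/
abbrev BoolProd (n : ℕ) : Type 1 := lp (fun m : BoolModel n => m.C) ∞

instance (n : ℕ) : CStarAlgebra (BoolProd n) where

theorem starProjection_norm_le {C : Type*} [CStarAlgebra C] {p : C}
    (hp : IsStarProjection p) : ‖p‖ ≤ 1 := by
  have h : ‖p‖ * ‖p‖ = ‖p‖ := by
    rw [← CStarRing.norm_star_mul_self (x := p), hp.isSelfAdjoint.star_eq, hp.isIdempotentElem.eq]
  nlinarith [norm_nonneg p]

/-- The family of the elements `u i j` of all realizations. -/
def prodU (n : ℕ) (i j : Fin n) : BoolProd n :=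
  ⟨fun m => m.u i j, memℓp_infty ⟨1, by
    rintro _ ⟨m, rfl⟩
    exact starProjection_norm_le (m.rel.proj i j)⟩⟩

/-- The family of the projections `P` of all realizations. -/
def prodP (n : ℕ) : BoolProd n :=
  ⟨fun m => m.P, memℓp_infty ⟨1, by
    rintro _ ⟨m, rfl⟩
    exact starProjection_norm_le m.rel.proj_P⟩⟩

/-- `B_s(n)`: the universal unital C*-algebra generated by the `u i j` and `P` subject to
`BoolRelations`, realized as the unital C*-subalgebra generated by the universal families inside
the product of all realizations.  (A C*-algebra generated by finitely many elements is separable,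
hence of cardinality at most the continuum, so realizations on types in `Type` suffice.) -/
def Bs (n : ℕ) : StarSubalgebra ℂ (BoolProd n) :=
  (StarAlgebra.adjoin ℂ
    (Set.range (fun ij : Fin n × Fin n => prodU n ij.1 ij.2) ∪ {prodP n})).topologicalClosure

instance (n : ℕ) : IsClosed (Bs n : Set (BoolProd n)) :=
  StarSubalgebra.isClosed_topologicalClosure _

/-- The standard generators `u i j` of `B_s(n)`. -/
def uGen {n : ℕ} (i j : Fin n) : Bs n :=
  ⟨prodU n i j, StarSubalgebra.le_topologicalClosure _
    (StarAlgebra.subset_adjoin ℂ _ (Or.inl ⟨(i, j), rfl⟩))⟩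

/-- The invariant projection `P` of `B_s(n)`. -/
def PGen (n : ℕ) : Bs n :=
  ⟨prodP n, StarSubalgebra.le_topologicalClosure _ (StarAlgebra.subset_adjoin ℂ _ (Or.inr rfl))⟩

/-- The boolean permutation quantum semigroup `𝓑_s(n) = P B_s(n) P`, as a complex vector space; the
unit of this C*-algebra is `P`. -/
def BsCorner (n : ℕ) : Submodule ℂ (Bs n) :=
  LinearMap.range (LinearMap.mulLeft ℂ (PGen n) ∘ₗ LinearMap.mulRight ℂ (PGen n))

/-- The compression `b ↦ P b P` of `B_s(n)` onto `𝓑_s(n)`. -/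
def compress (n : ℕ) : Bs n →ₗ[ℂ] BsCorner n :=
  (LinearMap.mulLeft ℂ (PGen n) ∘ₗ LinearMap.mulRight ℂ (PGen n)).rangeRestrict

theorem coe_compress {n : ℕ} (b : Bs n) : (compress n b : Bs n) = PGen n * (b * PGen n) := rfl

theorem boolRelations_Bs (n : ℕ) : BoolRelations (uGen (n := n)) (PGen n) where
  proj i j := by
    constructor
    · apply Subtype.ext; apply lp.ext; funext m
      exact (m.rel.proj i j).isIdempotentElem
    · apply Subtype.ext; apply lp.ext; funext m
      exact (m.rel.proj i j).isSelfAdjoint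
  proj_P := by
    constructor
    · apply Subtype.ext; apply lp.ext; funext m
      exact m.rel.proj_P.isIdempotentElem
    · apply Subtype.ext; apply lp.ext; funext m
      exact m.rel.proj_P.isSelfAdjoint
  row i k l h := by
    apply Subtype.ext; apply lp.ext; funext m
    exact m.rel.row i k l h
  col i k l h := by
    apply Subtype.ext; apply lp.ext; funext m
    exact m.rel.col i k l h
  sum i := by
    apply Subtype.ext; apply lp.ext; funext m
    have := m.rel.sum i
    rw [AddSubmonoidClass.coe_finsetSum, lp.coeFn_sum, Finset.sum_apply]
    exact this

/-- The coordinate of a bounded family at a realization, as a `*`-homomorphism. -/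
def evalModel {n : ℕ} (m : BoolModel n) : BoolProd n →⋆ₐ[ℂ] m.C where
  toFun f := f m
  map_one' := rfl
  map_mul' _ _ := rfl
  map_zero' := rfl
  map_add' _ _ := rfl
  commutes' _ := rfl
  map_star' _ := rfl

/-- The universal property of `B_s(n)`. -/
theorem Bs_universal {n : ℕ} {C : Type} [CStarAlgebra C] {u : Fin n → Fin n → C} {P : C}
    (h : BoolRelations u P) :
    ∃! π : Bs n →⋆ₐ[ℂ] C, (∀ i j, π (uGen i j) = u i j) ∧ π (PGen n) = P := by
  rcases subsingleton_or_nontrivial C with hC | hC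
  · refine ⟨{ toFun := fun _ => 0, map_one' := Subsingleton.elim _ _,
              map_mul' := fun _ _ => Subsingleton.elim _ _, map_zero' := rfl,
              map_add' := fun _ _ => Subsingleton.elim _ _,
              commutes' := fun _ => Subsingleton.elim _ _,
              map_star' := fun _ => Subsingleton.elim _ _ },
      ⟨fun _ _ => Subsingleton.elim _ _, Subsingleton.elim _ _⟩, ?_⟩
    intro π _
    exact DFunLike.ext _ _ fun _ => Subsingleton.elim _ _
  · refine ⟨(evalModel ⟨C, u, P, h⟩).comp (Bs n).subtype, ⟨fun _ _ => rfl, rfl⟩, ?_⟩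
    rintro π ⟨hu, hP⟩
    have hc : ∀ ρ : Bs n →⋆ₐ[ℂ] C, Continuous ρ := fun ρ =>
      (AddMonoidHomClass.lipschitz_of_bound_nnnorm ρ 1 fun a => by
        simpa using NonUnitalStarAlgHom.nnnorm_apply_le ρ a).continuous
    refine StarAlgHom.ext_topologicalClosure (hc π) (hc _) ?_
    refine StarAlgHom.ext_adjoin ?_
    rintro ⟨a, ha⟩ (⟨⟨i, j⟩, rfl⟩ | rfl)
    · exact hu i j
    · exact hP

/-! ### The linear coaction and the invariance condition -/

/-- The linear coaction `L_n` of `𝓑_s(n)` on `ℂ⟨X_1, …, X_n⟩`: it is given on the basis of monomials by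
`X_{i_1} ⋯ X_{i_k} ↦ ∑_{j_1, …, j_k} X_{j_1} ⋯ X_{j_k} ⊗ P u_{j_1 i_1} ⋯ u_{j_k i_k} P`. -/
def linearCoaction (n : ℕ) :
    FreeAlgebra ℂ (Fin n) →ₗ[ℂ] FreeAlgebra ℂ (Fin n) ⊗[ℂ] BsCorner n :=
  (FreeAlgebra.basisFreeMonoid ℂ (Fin n)).constr ℂ fun w =>
    ∑ j : Fin w.toList.length → Fin n,
      (List.ofFn fun l => FreeAlgebra.ι ℂ (j l)).prod ⊗ₜ[ℂ]
        compress n (List.ofFn fun l => uGen (j l) (w.toList.get l)).prod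

theorem linearCoaction_monomial (n : ℕ) (w : List (Fin n)) :
    linearCoaction n (w.map (FreeAlgebra.ι ℂ)).prod =
      ∑ j : Fin w.length → Fin n,
        (List.ofFn fun l => FreeAlgebra.ι ℂ (j l)).prod ⊗ₜ[ℂ]
          compress n (List.ofFn fun l => uGen (j l) (w.get l)).prod := by
  have h : (w.map (FreeAlgebra.ι ℂ)).prod =
      FreeAlgebra.basisFreeMonoid ℂ (Fin n) (FreeMonoid.ofList w) := by
    simp [FreeAlgebra.basisFreeMonoid, FreeAlgebra.equivMonoidAlgebraFreeMonoid]
  rw [h, linearCoaction, Module.Basis.constr_basis]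
  rfl

/-- The joint distribution of `x_1, …, x_n`, a linear functional on `ℂ⟨X_1, …, X_n⟩`. -/
def jointDistribution {A : Type*} [Ring A] [Algebra ℂ A] (φ : A →ₗ[ℂ] ℂ) {n : ℕ}
    (x : Fin n → A) : FreeAlgebra ℂ (Fin n) →ₗ[ℂ] ℂ :=
  φ ∘ₗ (FreeAlgebra.lift ℂ x).toLinearMap

/-- The joint distribution `μ` of the sequence is invariant under the linear coactions of the
boolean permutation quantum semigroups: `(μ ⊗ id) (L_n p) = μ(p) P` for all `n` and `p`. -/
def BooleanInvariant {A : Type*} [Ring A] [Algebra ℂ A] (φ : A →ₗ[ℂ] ℂ) (x : ℕ → A) : Prop :=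
  ∀ (n : ℕ) (p : FreeAlgebra ℂ (Fin n)),
    TensorProduct.lid ℂ (BsCorner n)
        ((jointDistribution φ fun i : Fin n => x i).rTensor (BsCorner n) (linearCoaction n p)) =
      jointDistribution φ (fun i : Fin n => x i) p • compress n 1

/-! ### Polynomials with coefficients in an algebra -/

section Polynomials

variable (B : Type*) [NonUnitalRing B] [Module ℂ B]

/-- The relations which make the coefficients `some b`, `b : B`, add, scale and multiply as in `B`;
the letter `none` is the indeterminate. -/
inductive PolyRel : FreeAlgebra ℂ (Option B) → FreeAlgebra ℂ (Option B) → Prop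
  | add (a b : B) : PolyRel (FreeAlgebra.ι ℂ (some (a + b)))
      (FreeAlgebra.ι ℂ (some a) + FreeAlgebra.ι ℂ (some b))
  | smul (c : ℂ) (a : B) : PolyRel (FreeAlgebra.ι ℂ (some (c • a)))
      (c • FreeAlgebra.ι ℂ (some a))
  | mul (a b : B) : PolyRel (FreeAlgebra.ι ℂ (some (a * b)))
      (FreeAlgebra.ι ℂ (some a) * FreeAlgebra.ι ℂ (some b))

/-- The unital algebra freely generated by the (not necessarily unital) algebra `B` and an
indeterminate `X`. -/
abbrev NCPoly : Type _ := RingQuot (PolyRel B)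

variable {B}

/-- The coefficient `b`, as an element of the algebra freely generated by `B` and `X`. -/
def NCPoly.C (b : B) : NCPoly B := RingQuot.mkAlgHom ℂ (PolyRel B) (FreeAlgebra.ι ℂ (some b))

/-- The indeterminate `X`. -/
def NCPoly.X : NCPoly B := RingQuot.mkAlgHom ℂ (PolyRel B) (FreeAlgebra.ι ℂ none)

variable (B) in
/-- `B⟨X⟩₀`, the `B`-polynomials without constant term: the linear span of the monomials
`b_0 X b_1 X ⋯ X b_n` with `n ≥ 1`, where each `b_k` is an element of `B` or a scalar. -/
def NCPoly.noConst : Submodule ℂ (NCPoly B) :=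
  Submodule.span ℂ {p | ∃ (b₀ : NCPoly B) (l : List (NCPoly B)), l ≠ [] ∧
    (∀ b ∈ b₀ :: l, b ∈ Set.range (NCPoly.C (B := B)) ∪ Set.range (algebraMap ℂ (NCPoly B))) ∧
    p = b₀ * (l.map fun b => NCPoly.X * b).prod}

/-- Evaluation `p ↦ p(x)` of `B`-polynomials at an element `x` of a unital algebra containing `B`
as a subalgebra. -/
def NCPoly.eval {A : Type*} [Ring A] [Algebra ℂ A] {B : NonUnitalSubalgebra ℂ A} (x : A) :
    NCPoly B →ₐ[ℂ] A :=
  RingQuot.liftAlgHom ℂ ⟨FreeAlgebra.lift ℂ fun o => o.elim x fun b : B => (b : A), by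
    intro p q h
    cases h <;> simp⟩

theorem NCPoly.eval_C {A : Type*} [Ring A] [Algebra ℂ A] {B : NonUnitalSubalgebra ℂ A} (x : A)
    (b : B) : NCPoly.eval x (NCPoly.C b) = (b : A) := by
  simp [NCPoly.eval, NCPoly.C]

theorem NCPoly.eval_X {A : Type*} [Ring A] [Algebra ℂ A] {B : NonUnitalSubalgebra ℂ A} (x : A) :
    NCPoly.eval x (NCPoly.X : NCPoly B) = x := by
  simp [NCPoly.eval, NCPoly.X]

end Polynomials

/-! ### Von Neumann algebras, normal states and the tail algebra -/

section VonNeumann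

variable {H : Type u} [NormedAddCommGroup H] [InnerProductSpace ℂ H] [CompleteSpace H]
  (A : VonNeumannAlgebra H)

/-- The inclusion of a von Neumann algebra into `B(H)` with the weak operator topology. -/
def toWOT : A.toStarSubalgebra →ₐ[ℂ] (H →WOT[ℂ] H) :=
  (ContinuousLinearMapWOT.algEquiv ℂ).symm.toAlgHom.comp A.toStarSubalgebra.toSubalgebra.val

instance : IsScalarTower ℂ (H →WOT[ℂ] H) (H →WOT[ℂ] H) := ⟨fun _ _ _ => rfl⟩

instance : SMulCommClass ℂ (H →WOT[ℂ] H) (H →WOT[ℂ] H) :=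
  ⟨fun c a b => ContinuousLinearMapWOT.ext fun v => (map_smul a c (b v)).symm⟩

/-- The weak operator topology on a von Neumann algebra. -/
@[reducible]
def wot : TopologicalSpace A.toStarSubalgebra := TopologicalSpace.induced (toWOT A) inferInstance

variable {A}

/-- A linear functional is normal if it is continuous for the weak operator topology on bounded
sets (equivalently, ultraweakly continuous). -/
def IsNormalFunctional (φ : A.toStarSubalgebra →ₗ[ℂ] ℂ) : Prop :=
  ∀ r : ℝ, @ContinuousOn _ _ (wot A) _ φ {a | ‖a‖ ≤ r}

/-- A linear map between von Neumann algebras is normal if it is continuous for the weak operator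
topologies on bounded sets. -/
def IsNormalMap (E : A.toStarSubalgebra →ₗ[ℂ] A.toStarSubalgebra) : Prop :=
  ∀ r : ℝ, @ContinuousOn _ _ (wot A) (wot A) E {a | ‖a‖ ≤ r}

/-- Normal states. -/
structure IsNormalState (φ : A.toStarSubalgebra →ₗ[ℂ] ℂ) : Prop where
  nonneg : ∀ a, 0 ≤ φ (star a * a)
  map_one : φ 1 = 1
  normal : IsNormalFunctional φ

/-- `φ` is non-degenerated: `φ(a x b) = 0` for all `a`, `b` only if `x = 0`. -/
def NonDegenerated (φ : A.toStarSubalgebra →ₗ[ℂ] ℂ) : Prop :=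
  ∀ x, (∀ a b, φ (a * x * b) = 0) → x = 0

/-- The closure, in the weak operator topology, of the non-unital algebra generated by `S`. -/
def wotAlg (S : Set A.toStarSubalgebra) : NonUnitalSubalgebra ℂ A.toStarSubalgebra :=
  (NonUnitalAlgebra.adjoin ℂ (toWOT A '' S)).topologicalClosure.comap (toWOT A)

/-- The non-unital tail algebra of the sequence `x`. -/
def tailAlg (x : ℕ → A.toStarSubalgebra) : NonUnitalSubalgebra ℂ A.toStarSubalgebra :=
  ⨅ n : ℕ, wotAlg (x '' {k | n ≤ k})

/-- `E` is a normal `φ`-preserving conditional expectation onto the subalgebra `T`. -/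
structure IsNormalCondExp (φ : A.toStarSubalgebra →ₗ[ℂ] ℂ)
    (T : NonUnitalSubalgebra ℂ A.toStarSubalgebra)
    (E : A.toStarSubalgebra →ₗ[ℂ] A.toStarSubalgebra) : Prop where
  mem : ∀ a, E a ∈ T
  id_on : ∀ t ∈ T, E t = t
  left_module : ∀ t ∈ T, ∀ a, E (t * a) = t * E a
  right_module : ∀ t ∈ T, ∀ a, E (a * t) = E a * t
  preserving : ∀ a, φ (E a) = φ a
  normal : IsNormalMap E

end VonNeumann

end BoolDeFinetti

end

/-! ### Words with the same pattern of repetitions of neighbouring letters -/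

/-! The universal algebra enters through a single representation, on `ℓ²(S_n)`: `u j i` is the
rank-one projection onto the indicator function of `{σ | σ i = j}`, and `P` projects onto the
constants. A coefficient `⟪v, u_{j₁i₁} ⋯ u_{jₖiₖ} v⟫` of rank-one projections splits into inner
products of consecutive indicators, and since `S_n` is doubly transitive these see the column
indices only through the equalities `i_l = i_{l+1}`. Invariance expands `φ(x_w)` with these
coefficients. Hence a moment depends only on which neighbouring letters agree
(`BooleanInvariant.moment_congr`), and this is all that is used of invariance afterwards.

In the cyclic representation of `φ`, faithful because `φ` is non-degenerated, matrix coefficients of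
shifted words between word vectors are eventually constant, so shifted words converge. Let `Q` be
the projection onto the closed span of the limits applied to `Ω`. Comparing patterns gives `QΩ = Ω`,
`π(lim) = Q π(x_w) Q` (`rep_limWord`), and `π(x_i) Q π(x_j) = π(x_i) π(x_j)` for `i ≠ j`
(`mul_tailProj_mul`): shifting what follows `x_i` far away leaves the junction an inequality. As `1`
is a weak limit of combinations of words, `Q = π(e)` with `e` in `A`. The tail algebra is `e A e`,
the expectation is `a ↦ e a e`, and factorization amounts to inserting `e` between polynomials in
different variables.

Normality is continuity on bounded sets only, so identities pass from words to `A` through a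
substitute for Kaplansky's density theorem, `BoundedlyClosed.wotAlg_le`, based on the bounded
transform `a ↦ a (a + i)⁻¹`. -/

namespace BoolDeFinetti

/-- Two words have the same pattern if they have the same length, and neighbouring letters of the
first one are equal if and only if they are equal in the second one. -/
inductive SamePattern {α β : Type*} : List α → List β → Prop
  | nil : SamePattern [] []
  | single (a : α) (b : β) : SamePattern [a] [b]
  | cons {a a' : α} {b b' : β} {l : List α} {l' : List β} (h : a = a' ↔ b = b')
      (hl : SamePattern (a' :: l) (b' :: l')) : SamePattern (a :: a' :: l) (b :: b' :: l')

namespace SamePattern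

variable {α β γ : Type*}

theorem length_eq {l : List α} {l' : List β} (h : SamePattern l l') : l.length = l'.length := by
  induction h with
  | nil => rfl
  | single => rfl
  | cons _ _ ih => simpa using ih

theorem map_map {f : α → β} {g : α → γ} (hf : Function.Injective f) (hg : Function.Injective g)
    (l : List α) : SamePattern (l.map f) (l.map g) := by
  induction l with
  | nil => exact nil
  | cons a l ih =>
    cases l with
    | nil => exact single _ _
    | cons b l => exact cons (hf.eq_iff.trans hg.eq_iff.symm) ih

theorem map {f : α → γ} (hf : Function.Injective f) (l : List α) : SamePattern l (l.map f) := by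
  simpa using map_map Function.injective_id hf l

theorem refl (l : List α) : SamePattern l l := by
  simpa using map Function.injective_id l

theorem of_map {f : α → γ} {g : β → γ} (hf : Function.Injective f) (hg : Function.Injective g)
    (l : List α) (l' : List β) (h : SamePattern (l.map f) (l'.map g)) : SamePattern l l' := by
  induction l generalizing l' with
  | nil => cases l' with
    | nil => exact nil
    | cons => cases h
  | cons a l ih =>
    cases l with
    | nil => cases l' with
      | nil => cases h
      | cons b l' => cases l' with
        | nil => exact single _ _
        | cons => cases h
    | cons a' l =>
      cases l' with
      | nil => cases h
      | cons b l' => cases l' with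
        | nil => cases h
        | cons b' l' =>
          cases h with
          | cons h1 h2 => exact cons (by rwa [hf.eq_iff, hg.eq_iff] at h1) (ih (b' :: l') h2)

/-- Only the pair of letters meeting at the junction is new. Every later comparison of moments
reduces to checking such junctions. -/
theorem append {u v : List α} {u' v' : List β} (hu : SamePattern u u') (hv : SamePattern v v')
    (h : ∀ a ∈ u.getLast?, ∀ b ∈ v.head?, ∀ a' ∈ u'.getLast?, ∀ b' ∈ v'.head?, a = b ↔ a' = b') :
    SamePattern (u ++ v) (u' ++ v') := by
  induction hu with
  | nil => exact hv
  | single a b =>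
    cases hv with
    | nil => exact single _ _
    | single a' b' => exact cons (h a rfl a' rfl b rfl b' rfl) (single _ _)
    | cons h1 h2 => exact cons (h a rfl _ rfl b rfl _ rfl) (cons h1 h2)
  | cons h1 h2 ih => exact cons h1 (ih (by simpa using h))

theorem append_of_disjoint {u v : List α} {u' v' : List β} (hu : SamePattern u u')
    (hv : SamePattern v v') (h : ∀ a ∈ u, ∀ b ∈ v, a ≠ b) (h' : ∀ a ∈ u', ∀ b ∈ v', a ≠ b) :
    SamePattern (u ++ v) (u' ++ v') :=
  append hu hv fun a ha b hb a' ha' b' hb' =>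
    iff_of_false (h a (List.mem_of_getLast? ha) b (List.mem_of_head? hb))
      (h' a' (List.mem_of_getLast? ha') b' (List.mem_of_head? hb'))

end SamePattern

/-! ### A concrete realization of the boolean permutation quantum semigroup -/

namespace PermModel

variable {n : ℕ}

/-- The space `ℓ²(S_n)`. -/
abbrev Space (n : ℕ) : Type := EuclideanSpace ℂ (Equiv.Perm (Fin n))

/-- The constant function `1`. -/
noncomputable def v (n : ℕ) : Space n := WithLp.toLp 2 fun _ => 1

/-- The indicator function of the permutations mapping `i` to `j`. -/
noncomputable def e (j i : Fin n) : Space n := WithLp.toLp 2 fun σ => if σ i = j then 1 else 0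

/-- The projection onto the multiples of `e j i`. -/
noncomputable def u (j i : Fin n) : Space n →L[ℂ] Space n := (ℂ ∙ e j i).starProjection

/-- The projection onto the constant functions. -/
noncomputable def P (n : ℕ) : Space n →L[ℂ] Space n := (ℂ ∙ v n).starProjection

/-- Double transitivity of `S_n`: some `τ` carries `(i', k')` to `(i, k)`, and the sum is reindexed
by `σ ↦ σ τ`. -/
theorem sum_perm_eq (f : Fin n → Fin n → ℂ) {i k i' k' : Fin n} (h : i = k ↔ i' = k') :
    ∑ σ : Equiv.Perm (Fin n), f (σ i) (σ k) = ∑ σ : Equiv.Perm (Fin n), f (σ i') (σ k') := by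
  obtain ⟨τ, h1, h2⟩ : ∃ τ : Equiv.Perm (Fin n), τ i' = i ∧ τ k' = k := by
    by_cases hik : i = k
    · obtain rfl := hik
      obtain rfl := h.1 rfl
      exact ⟨Equiv.swap i' i, by simp, by simp⟩
    · have hik' : i' ≠ k' := fun h' => hik (h.2 h')
      -- The first transposition sends `i'` to `i`; the second sends the image of `k'` to `k` and
      -- fixes `i`, which differs from both of its letters.
      refine ⟨Equiv.swap (Equiv.swap i' i k') k * Equiv.swap i' i, ?_, by simp⟩
      rw [Equiv.Perm.mul_apply, Equiv.swap_apply_left, Equiv.swap_apply_of_ne_of_ne _ hik]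
      intro h'
      apply hik'
      apply (Equiv.swap i' i).injective
      rw [← h', Equiv.swap_apply_left]
  rw [← Equiv.sum_comp (Equiv.mulRight τ) fun σ : Equiv.Perm (Fin n) => f (σ i') (σ k')]
  simp [h1, h2]

theorem inner_e_e (j i j' k : Fin n) :
    ⟪e j i, e j' k⟫_ℂ = ∑ σ : Equiv.Perm (Fin n), if σ i = j ∧ σ k = j' then 1 else 0 := by
  rw [PiLp.inner_apply]
  refine Finset.sum_congr rfl fun σ _ => ?_
  by_cases h1 : σ i = j <;> by_cases h2 : σ k = j' <;> simp [e, h1, h2]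

theorem inner_e_v (j i : Fin n) :
    ⟪e j i, v n⟫_ℂ = ∑ σ : Equiv.Perm (Fin n), if σ i = j then 1 else 0 := by
  rw [PiLp.inner_apply]
  refine Finset.sum_congr rfl fun σ _ => ?_
  by_cases h1 : σ i = j <;> simp [e, v, h1]

theorem inner_v_e (j i : Fin n) :
    ⟪v n, e j i⟫_ℂ = ∑ σ : Equiv.Perm (Fin n), if σ i = j then 1 else 0 := by
  rw [PiLp.inner_apply]
  refine Finset.sum_congr rfl fun σ _ => ?_
  by_cases h1 : σ i = j <;> simp [e, v, h1]

theorem inner_e_e_congr (j j' : Fin n) {i k i' k' : Fin n} (h : i = k ↔ i' = k') :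
    ⟪e j i, e j' k⟫_ℂ = ⟪e j i', e j' k'⟫_ℂ := by
  rw [inner_e_e, inner_e_e, sum_perm_eq (fun a b => if a = j ∧ b = j' then 1 else 0) h]

theorem inner_e_v_congr (j i i' : Fin n) : ⟪e j i, v n⟫_ℂ = ⟪e j i', v n⟫_ℂ := by
  rw [inner_e_v, inner_e_v]
  exact sum_perm_eq (fun a _ => if a = j then 1 else 0) (i := i) (k := i) (i' := i') (k' := i')
    (by simp)

theorem inner_v_e_congr (j i i' : Fin n) : ⟪v n, e j i⟫_ℂ = ⟪v n, e j i'⟫_ℂ := by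
  rw [inner_v_e, inner_v_e]
  exact sum_perm_eq (fun a _ => if a = j then 1 else 0) (i := i) (k := i) (i' := i') (k' := i')
    (by simp)

theorem u_apply (j i : Fin n) (w : Space n) :
    u j i w = (⟪e j i, w⟫_ℂ / ⟪e j i, e j i⟫_ℂ) • e j i := by
  rw [u, Submodule.starProjection_singleton, inner_self_eq_norm_sq_to_K]
  simp

theorem u_mul_u {i j k l : Fin n} (h : ⟪e i j, e k l⟫_ℂ = 0) : u i j * u k l = 0 := by
  ext1 w
  rw [mul_apply_eq_comp, u_apply k l, u_apply, inner_smul_right, h]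
  simp

/-- The constant function and `e j i` have the same inner product with `e j i`, since an indicator
is its own square. -/
theorem u_apply_v (j i : Fin n) : u j i (v n) = e j i := by
  rw [u_apply]
  have h : ⟪e j i, v n⟫_ℂ = ⟪e j i, e j i⟫_ℂ := by
    rw [inner_e_v, inner_e_e]; simp
  rw [h]
  by_cases h0 : e j i = 0
  · simp [h0]
  · rw [div_self (inner_self_ne_zero.2 h0), one_smul]

theorem sum_e (i : Fin n) : ∑ k, e k i = v n := by
  ext σ
  simp [e, v]

/-- Rows are orthogonal because permutations are injective, columns because they are single-valued:
the supports are disjoint. The column sums hold because the events `σ i = k` partition `S_n`, so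
that the `e k i` add up to `v`. -/
theorem boolRelations (n : ℕ) : BoolRelations (u (n := n)) (P n) where
  proj i j := isStarProjection_starProjection
  proj_P := isStarProjection_starProjection
  row i k l h := by
    apply u_mul_u
    rw [inner_e_e]
    refine Finset.sum_eq_zero fun σ _ => if_neg ?_
    rintro ⟨h1, h2⟩
    exact h (σ.injective (h1.trans h2.symm))
  col i k l h := by
    apply u_mul_u
    rw [inner_e_e]
    refine Finset.sum_eq_zero fun σ _ => if_neg ?_
    rintro ⟨h1, h2⟩
    exact h (h1.symm.trans h2)
  sum i := by
    ext1 w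
    rw [sum_apply]
    simp_rw [mul_apply_eq_comp]
    obtain ⟨c, hc⟩ : ∃ c : ℂ, P n w = c • v n := by
      have := Submodule.starProjection_apply_mem (ℂ ∙ v n) w
      rw [Submodule.mem_span_singleton] at this
      obtain ⟨c, hc⟩ := this
      exact ⟨c, hc.symm⟩
    simp_rw [hc, map_smul, u_apply_v]
    rw [← Finset.smul_sum, sum_e]

/-- The representation of `B_s(n)` on `ℓ²(S_n)`. -/
noncomputable def rep (n : ℕ) : Bs n →⋆ₐ[ℂ] (Space n →L[ℂ] Space n) :=
  (Bs_universal (boolRelations n)).exists.choose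

theorem rep_uGen (j i : Fin n) : rep n (uGen j i) = u j i :=
  (Bs_universal (boolRelations n)).exists.choose_spec.1 j i

theorem rep_PGen (n : ℕ) : rep n (PGen n) = P n :=
  (Bs_universal (boolRelations n)).exists.choose_spec.2

/-- Peeling off the rank-one `u k a` leaves `⟪e j i, e k a⟫ / ⟪e k a, e k a⟫` times a shorter
coefficient. The first factor depends on the columns only through whether `i = a`. Carrying the
preceding column `i` in the bra is what makes the induction close. -/
theorem inner_e_prod_congr {l l' : List (Fin n)} {i i' : Fin n}
    (h : SamePattern (i :: l) (i' :: l')) (j : Fin n) (m : List (Fin n)) :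
    ⟪e j i, (List.zipWith u m l).prod (v n)⟫_ℂ = ⟪e j i', (List.zipWith u m l').prod (v n)⟫_ℂ := by
  induction m generalizing l l' i i' j with
  | nil => simpa using inner_e_v_congr j i i'
  | cons k m ih =>
    cases h with
    | single => simpa using inner_e_v_congr j i i'
    | cons h1 h2 =>
      rename_i a b l l'
      simp only [List.zipWith_cons_cons, List.prod_cons, mul_apply_eq_comp, u_apply,
        inner_smul_right]
      rw [ih h2 k, inner_e_e_congr j k h1,
        inner_e_e_congr k k (i := a) (k := a) (i' := b) (k' := b) (by simp)]

theorem inner_v_prod_congr {l l' : List (Fin n)} (h : SamePattern l l') (m : List (Fin n)) :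
    ⟪v n, (List.zipWith u m l).prod (v n)⟫_ℂ = ⟪v n, (List.zipWith u m l').prod (v n)⟫_ℂ := by
  cases l with
  | nil => cases h; rfl
  | cons a l =>
    cases l' with
    | nil => cases h
    | cons b l' =>
      cases m with
      | nil => rfl
      | cons k m =>
        simp only [List.zipWith_cons_cons, List.prod_cons, mul_apply_eq_comp, u_apply,
          inner_smul_right]
        rw [inner_e_prod_congr h k, inner_v_e_congr k a b,
          inner_e_e_congr k k (i := a) (k := a) (i' := b) (k' := b) (by simp)]

end PermModel

/-! ### Moments of boolean invariant sequences -/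

section Moments

variable {n : ℕ}

/-- The linear functional on `𝓑_s(n)` given by the vector `v` of the realization on `ℓ²(S_n)`. -/
noncomputable def vectorFunctional (n : ℕ) : BsCorner n →ₗ[ℂ] ℂ where
  toFun b := ⟪PermModel.v n, PermModel.rep n b (PermModel.v n)⟫_ℂ
  map_add' a b := by
    rw [Submodule.coe_add, map_add, add_apply, inner_add_right]
  map_smul' c a := by
    rw [RingHom.id_apply, smul_eq_mul, Submodule.coe_smul, map_smul, smul_apply,
      inner_smul_right]

theorem P_apply_v (n : ℕ) : PermModel.P n (PermModel.v n) = PermModel.v n :=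
  Submodule.starProjection_eq_self_iff.2 (Submodule.mem_span_singleton_self _)

theorem vectorFunctional_compress (b : Bs n) :
    vectorFunctional n (compress n b) = ⟪PermModel.v n, PermModel.rep n b (PermModel.v n)⟫_ℂ := by
  change ⟪PermModel.v n, PermModel.rep n (compress n b) (PermModel.v n)⟫_ℂ = _
  rw [coe_compress, map_mul, map_mul, PermModel.rep_PGen, mul_apply_eq_comp, mul_apply_eq_comp,
    P_apply_v, PermModel.P, ← Submodule.inner_starProjection_left_eq_right, ← PermModel.P, P_apply_v]

theorem vectorFunctional_monomial (w : List (Fin n)) (j : Fin w.length → Fin n) :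
    vectorFunctional n (compress n (List.ofFn fun l => uGen (j l) (w.get l)).prod) =
      ⟪PermModel.v n, (List.zipWith PermModel.u (List.ofFn j) w).prod (PermModel.v n)⟫_ℂ := by
  have h : (List.ofFn fun l => uGen (j l) (w.get l)).map (PermModel.rep n) =
      List.zipWith PermModel.u (List.ofFn j) w := by
    apply List.ext_getElem
    · simp
    · intro i h1 h2
      simp [PermModel.rep_uGen]
  rw [vectorFunctional_compress, map_list_prod, h]

variable {A : Type*} [Ring A] [Algebra ℂ A] {φ : A →ₗ[ℂ] ℂ} {x : ℕ → A}

theorem lid_rTensor_sum {R V M ι : Type*} [CommRing R] [AddCommGroup V] [Module R V]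
    [AddCommGroup M] [Module R M] (f : V →ₗ[R] R) (s : Finset ι) (a : ι → V) (m : ι → M) :
    TensorProduct.lid R M (f.rTensor M (∑ i ∈ s, a i ⊗ₜ[R] m i)) = ∑ i ∈ s, f (a i) • m i := by
  simp [map_sum]

/-- Invariance tested against the vector functional of `v`, to which compression by `P` is
invisible. The factor `⟪v, v⟫` remains because `v` is not normalized. -/
theorem BooleanInvariant.moment_eq_sum (h : BooleanInvariant φ x) (w : List (Fin n)) :
    φ (w.map fun i : Fin n => x i).prod * ⟪PermModel.v n, PermModel.v n⟫_ℂ =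
      ∑ j : Fin w.length → Fin n, φ ((List.ofFn j).map fun i : Fin n => x i).prod *
        ⟪PermModel.v n, (List.zipWith PermModel.u (List.ofFn j) w).prod (PermModel.v n)⟫_ℂ := by
  have h1 := congrArg (vectorFunctional n) (h n (w.map (FreeAlgebra.ι ℂ)).prod)
  have h2 : ∀ l : List (Fin n), jointDistribution φ (fun i : Fin n => x i)
      (l.map (FreeAlgebra.ι ℂ)).prod = φ (l.map fun i : Fin n => x i).prod := by
    intro l
    have : (FreeAlgebra.lift ℂ fun i : Fin n => x i) ∘ FreeAlgebra.ι ℂ = fun i : Fin n => x i :=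
      FreeAlgebra.ι_comp_lift _
    rw [jointDistribution, LinearMap.comp_apply, AlgHom.toLinearMap_apply, map_list_prod,
      List.map_map, this]
  rw [linearCoaction_monomial, lid_rTensor_sum, map_sum (vectorFunctional n), map_smul (vectorFunctional n), vectorFunctional_compress,
    smul_eq_mul, h2] at h1
  rw [map_one, one_apply_eq_self] at h1
  rw [← h1]
  refine Finset.sum_congr rfl fun j _ => ?_
  rw [map_smul, vectorFunctional_monomial,
    smul_eq_mul, ← h2, List.map_ofFn]
  rfl

/-- The moments of a boolean invariant sequence depend only on the pattern of repetitions of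
neighbouring indices. -/
theorem BooleanInvariant.moment_congr (h : BooleanInvariant φ x) {w w' : List ℕ}
    (hw : SamePattern w w') : φ (w.map x).prod = φ (w'.map x).prod := by
  -- One `n` must accommodate both words, so that both moments are expanded in the same family of
  -- words `j`.
  obtain ⟨n, hn⟩ : ∃ n, ∀ i ∈ w ++ w', i < n := by
    obtain ⟨m, hm⟩ := (w ++ w').toFinset.bddAbove
    exact ⟨m + 1, fun i hi => Nat.lt_succ_of_le (hm (by simpa using hi))⟩
  lift w to List (Fin n) using fun i hi => hn i (by simp [hi])
  lift w' to List (Fin n) using fun i hi => hn i (by simp [hi])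
  have hw1 : SamePattern w w' := hw.of_map Fin.val_injective Fin.val_injective
  have hv : ⟪PermModel.v n, PermModel.v n⟫_ℂ ≠ 0 := by
    rw [inner_self_ne_zero]
    intro h0
    have := congrFun (congrArg WithLp.ofLp h0) 1
    simp [PermModel.v] at this
  have key := h.moment_eq_sum w
  have key' := h.moment_eq_sum w'
  rw [List.map_map, List.map_map]
  apply mul_right_cancel₀ hv
  refine key.trans (Eq.trans ?_ key'.symm)
  have hl := hw1.length_eq
  refine Fintype.sum_equiv (Equiv.arrowCongr (finCongr hl) (Equiv.refl _)) _ _ fun j => ?_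
  have hj : List.ofFn ((Equiv.arrowCongr (finCongr hl) (Equiv.refl _)) j) = List.ofFn j := by
    apply List.ext_getElem
    · simp [hl]
    · intro i h1 h2
      simp
  rw [hj, PermModel.inner_v_prod_congr hw1]

end Moments

end BoolDeFinetti

/-! ### The weak operator topology on a von Neumann algebra -/

namespace BoolDeFinetti

open Filter

section WeakOperatorTopology

variable {H : Type*} [NormedAddCommGroup H] [InnerProductSpace ℂ H] [CompleteSpace H]
  {A : VonNeumannAlgebra H}

/-- A commutant is norm closed, and `A` is its own bicommutant. Used as an instance, this makes `A`
a C*-algebra. -/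
theorem isClosed_toStarSubalgebra (A : VonNeumannAlgebra H) :
    IsClosed (A.toStarSubalgebra : Set (H →L[ℂ] H)) := by
  rw [VonNeumannAlgebra.coe_toStarSubalgebra, ← VonNeumannAlgebra.centralizer_centralizer]
  exact Set.isClosed_centralizer _

attribute [local instance] isClosed_toStarSubalgebra

theorem tendsto_toWOT_iff {ι : Type*} {F : Filter ι} {a : ι → A.toStarSubalgebra}
    {b : A.toStarSubalgebra} :
    Tendsto (fun i => toWOT A (a i)) F (𝓝 (toWOT A b)) ↔
      ∀ ξ η : H, Tendsto (fun i => ⟪η, (a i : H →L[ℂ] H) ξ⟫_ℂ) F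
        (𝓝 ⟪η, (b : H →L[ℂ] H) ξ⟫_ℂ) :=
  ContinuousLinearMapWOT.tendsto_iff_forall_inner_apply_tendsto

theorem tendsto_toWOT_of_tendsto {ι : Type*} {F : Filter ι} {a : ι → A.toStarSubalgebra}
    {b : A.toStarSubalgebra} (h : Tendsto a F (𝓝 b)) :
    Tendsto (fun i => toWOT A (a i)) F (𝓝 (toWOT A b)) :=
  ((ContinuousLinearMapWOT.continuous_ofCLM.comp continuous_subtype_val).tendsto b).comp h

theorem tendsto_toWOT_mul_mul {ι : Type*} {F : Filter ι} {a : ι → A.toStarSubalgebra}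
    {b : A.toStarSubalgebra} (h : Tendsto (fun i => toWOT A (a i)) F (𝓝 (toWOT A b)))
    (c d : A.toStarSubalgebra) :
    Tendsto (fun i => toWOT A (c * a i * d)) F (𝓝 (toWOT A (c * b * d))) := by
  simp_rw [map_mul]
  exact (h.const_mul (toWOT A c)).mul_const (toWOT A d)

/-- A bounded sesquilinear form which is a pointwise limit of forms given by bounded operators is
given by a bounded operator. -/
theorem exists_tendsto_inner {ι : Type*} (F : Ultrafilter ι) {a : ι → H →L[ℂ] H} {r : ℝ}
    (hr : ∀ᶠ i in (F : Filter ι), ‖a i‖ ≤ r) :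
    ∃ b : H →L[ℂ] H, ∀ ξ η : H, Tendsto (fun i => ⟪η, a i ξ⟫_ℂ) F (𝓝 ⟪η, b ξ⟫_ℂ) := by
  have hb : ∀ ξ η : H, ∀ᶠ i in (F : Filter ι), ‖⟪a i ξ, η⟫_ℂ‖ ≤ r * ‖ξ‖ * ‖η‖ := by
    intro ξ η
    filter_upwards [hr] with i hi
    calc ‖⟪a i ξ, η⟫_ℂ‖ ≤ ‖a i ξ‖ * ‖η‖ := norm_inner_le_norm _ _
      _ ≤ r * ‖ξ‖ * ‖η‖ := by
        gcongr
        exact (a i).le_of_opNorm_le hi ξ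
  have hlim : ∀ ξ η : H, ∃ l : ℂ, Tendsto (fun i => ⟪a i ξ, η⟫_ℂ) F (𝓝 l) := by
    intro ξ η
    have hc := isCompact_closedBall (0 : ℂ) (r * ‖ξ‖ * ‖η‖)
    obtain ⟨l, -, hl⟩ := hc.ultrafilter_le_nhds (F.map fun i => ⟪a i ξ, η⟫_ℂ) (by
      rw [le_principal_iff, Ultrafilter.mem_coe, Ultrafilter.mem_map]
      filter_upwards [hb ξ η] with i hi
      simpa using hi)
    exact ⟨l, hl⟩
  choose l hl using hlim
  -- Sesquilinearity passes to the limit by uniqueness of limits; boundedness then yields the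
  -- operator by the Riesz theorem.
  let B : H →ₗ⋆[ℂ] H →ₗ[ℂ] ℂ := LinearMap.mk₂'ₛₗ (starRingEnd ℂ) (RingHom.id ℂ) l
    (fun ξ ξ' η => tendsto_nhds_unique (hl _ _) (by
      simpa [inner_add_left] using (hl ξ η).add (hl ξ' η)))
    (fun c ξ η => tendsto_nhds_unique (hl _ _) (by
      simpa [inner_smul_left, mul_comm] using (hl ξ η).const_mul (starRingEnd ℂ c)))
    (fun ξ η η' => tendsto_nhds_unique (hl _ _) (by
      simpa [inner_add_right] using (hl ξ η).add (hl ξ η')))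
    (fun c ξ η => tendsto_nhds_unique (hl _ _) (by
      simpa [inner_smul_right] using (hl ξ η).const_mul c))
  have hB : ∀ ξ η, ‖B ξ η‖ ≤ r * ‖ξ‖ * ‖η‖ := fun ξ η =>
    le_of_tendsto (hl ξ η).norm (hb ξ η)
  let b := InnerProductSpace.continuousLinearMapOfBilin (B.mkContinuous₂ r hB)
  refine ⟨b, fun ξ η => ?_⟩
  have h1 : ⟪b ξ, η⟫_ℂ = l ξ η := InnerProductSpace.continuousLinearMapOfBilin_apply _ _ _
  rw [← inner_conj_symm, h1]
  simp_rw [← inner_conj_symm η]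
  exact (Complex.continuous_conj.tendsto _).comp (hl ξ η)

/-- A von Neumann algebra is closed for the weak operator topology. -/
theorem mem_of_tendsto_inner {ι : Type*} {F : Filter ι} [F.NeBot] {a : ι → A.toStarSubalgebra}
    {b : H →L[ℂ] H}
    (h : ∀ ξ η : H, Tendsto (fun i => ⟪η, (a i : H →L[ℂ] H) ξ⟫_ℂ) F (𝓝 ⟪η, b ξ⟫_ℂ)) :
    b ∈ A.toStarSubalgebra := by
  suffices b ∈ A.commutant.commutant by rwa [VonNeumannAlgebra.commutant_commutant] at this
  rw [VonNeumannAlgebra.mem_commutant_iff]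
  intro c hc
  rw [VonNeumannAlgebra.mem_commutant_iff] at hc
  ext1 ξ
  refine ext_inner_left ℂ fun η => ?_
  rw [mul_apply_eq_comp, mul_apply_eq_comp, ← ContinuousLinearMap.adjoint_inner_left]
  refine tendsto_nhds_unique (h ξ _) ?_
  convert h (c ξ) η using 2 with i
  rw [ContinuousLinearMap.adjoint_inner_left]
  have := congrArg (fun f : H →L[ℂ] H => f ξ) (hc (a i) (a i).2)
  simp only [mul_apply_eq_comp] at this
  rw [this]

/-- Bounded sets of a von Neumann algebra are relatively compact in the weak operator topology. -/
theorem exists_tendsto_toWOT {ι : Type*} (F : Ultrafilter ι) {a : ι → A.toStarSubalgebra} {r : ℝ}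
    (hr : ∀ᶠ i in (F : Filter ι), ‖a i‖ ≤ r) :
    ∃ b : A.toStarSubalgebra, Tendsto (fun i => toWOT A (a i)) F (𝓝 (toWOT A b)) := by
  obtain ⟨b, hb⟩ := exists_tendsto_inner F (a := fun i => (a i : H →L[ℂ] H)) hr
  exact ⟨⟨b, mem_of_tendsto_inner hb⟩, tendsto_toWOT_iff.2 hb⟩

/-- Filter form of normality: the bound is needed only eventually, since enlarging the ball to
radius `max r ‖b‖` also contains the limit. -/
theorem isNormalFunctional_iff {ψ : A.toStarSubalgebra →ₗ[ℂ] ℂ} :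
    IsNormalFunctional ψ ↔ ∀ (F : Filter A.toStarSubalgebra) (r : ℝ) (b : A.toStarSubalgebra),
      (∀ᶠ a in F, ‖a‖ ≤ r) → Tendsto (toWOT A) F (𝓝 (toWOT A b)) → Tendsto ψ F (𝓝 (ψ b)) := by
  constructor
  · intro h F r b hF hb
    have h1 := h (max r ‖b‖) b (show ‖b‖ ≤ _ from le_max_right _ _)
    refine Tendsto.mono_left h1 ?_
    refine le_inf ?_ ?_
    · rw [nhds_induced]
      exact tendsto_iff_comap.1 hb
    · rw [le_principal_iff]
      filter_upwards [hF] with a ha using ha.trans (le_max_left _ _)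
  · intro h r b _
    refine h _ r b ?_ ?_
    · exact mem_inf_of_right (mem_principal_self _)
    · refine Tendsto.mono_left ?_ inf_le_left
      rw [nhds_induced]
      exact tendsto_comap

theorem IsNormalFunctional.tendsto {ψ : A.toStarSubalgebra →ₗ[ℂ] ℂ} (h : IsNormalFunctional ψ)
    {ι : Type*} {F : Filter ι} {a : ι → A.toStarSubalgebra} {b : A.toStarSubalgebra} {r : ℝ}
    (hr : ∀ᶠ i in F, ‖a i‖ ≤ r) (hb : Tendsto (fun i => toWOT A (a i)) F (𝓝 (toWOT A b))) :
    Tendsto (fun i => ψ (a i)) F (𝓝 (ψ b)) := by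
  have := isNormalFunctional_iff.1 h (F.map a) r b hr (tendsto_map'_iff.2 hb)
  exact tendsto_map'_iff.1 this

/-! ### The density theorem -/

theorem mem_wotAlg_iff {S : Set A.toStarSubalgebra} {a : A.toStarSubalgebra} :
    a ∈ wotAlg S ↔
      toWOT A a ∈ closure (toWOT A '' (NonUnitalAlgebra.adjoin ℂ S : Set A.toStarSubalgebra)) := by
  have h : NonUnitalAlgebra.adjoin ℂ (toWOT A '' S) =
      (NonUnitalAlgebra.adjoin ℂ S).map (toWOT A) := by
    rw [NonUnitalAlgHom.map_adjoin]
  rw [wotAlg, h]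
  rfl

theorem subset_wotAlg (S : Set A.toStarSubalgebra) {a : A.toStarSubalgebra}
    (ha : a ∈ NonUnitalAlgebra.adjoin ℂ S) : a ∈ wotAlg S :=
  mem_wotAlg_iff.2 (subset_closure ⟨a, ha, rfl⟩)

theorem mem_wotAlg_of_tendsto {S : Set A.toStarSubalgebra} {ι : Type*} {F : Filter ι} [F.NeBot]
    {a : ι → A.toStarSubalgebra} {b : A.toStarSubalgebra} (ha : ∀ᶠ i in F, a i ∈ wotAlg S)
    (hb : Tendsto (fun i => toWOT A (a i)) F (𝓝 (toWOT A b))) : b ∈ wotAlg S := by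
  rw [mem_wotAlg_iff, ← closure_closure]
  exact mem_closure_of_tendsto hb (ha.mono fun i hi => mem_wotAlg_iff.1 hi)

theorem star_mem_adjoin {S : Set A.toStarSubalgebra} (hS : ∀ s ∈ S, IsSelfAdjoint s)
    {a : A.toStarSubalgebra} (ha : a ∈ NonUnitalAlgebra.adjoin ℂ S) :
    star a ∈ NonUnitalAlgebra.adjoin ℂ S := by
  induction ha using NonUnitalAlgebra.adjoin_induction with
  | mem s hs =>
    rw [(hS s hs).star_eq]
    exact NonUnitalAlgebra.subset_adjoin ℂ hs
  | add a b _ _ ha hb => rw [star_add]; exact add_mem ha hb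
  | zero => rw [star_zero]; exact zero_mem _
  | mul a b _ _ ha hb => rw [star_mul]; exact mul_mem hb ha
  | smul c a _ ha => rw [star_smul]; exact SMulMemClass.smul_mem _ ha

theorem continuous_star_toWOT : Continuous (star : (H →WOT[ℂ] H) → (H →WOT[ℂ] H)) := continuous_star

theorem toWOT_star (a : A.toStarSubalgebra) : toWOT A (star a) = star (toWOT A a) := rfl

theorem star_mem_wotAlg {S : Set A.toStarSubalgebra} (hS : ∀ s ∈ S, IsSelfAdjoint s)
    {a : A.toStarSubalgebra} (ha : a ∈ wotAlg S) : star a ∈ wotAlg S := by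
  rw [mem_wotAlg_iff] at ha ⊢
  rw [toWOT_star]
  refine map_mem_closure continuous_star_toWOT ha ?_
  rintro _ ⟨m, hm, rfl⟩
  exact ⟨star m, star_mem_adjoin hS hm, toWOT_star m⟩

/-- A selfadjoint operator in the weak closure of a selfadjoint algebra of operators is in the
strong closure of the selfadjoint operators of this algebra. -/
theorem mem_closure_selfAdjoint {S : Set A.toStarSubalgebra} (hS : ∀ s ∈ S, IsSelfAdjoint s)
    {h : A.toStarSubalgebra} (hsa : IsSelfAdjoint h) (hh : h ∈ wotAlg S) :
    ((h : H →L[ℂ] H) : H → H) ∈ closure ((fun a : A.toStarSubalgebra => ((a : H →L[ℂ] H) : H → H)) ''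
      {m | m ∈ NonUnitalAlgebra.adjoin ℂ S ∧ IsSelfAdjoint m}) := by
  set V : Set A.toStarSubalgebra := {m | m ∈ NonUnitalAlgebra.adjoin ℂ S ∧ IsSelfAdjoint m} with hV
  have h1 : toWOT A h ∈ closure (toWOT A '' V) := by
    rw [mem_wotAlg_iff] at hh
    -- The adjoint is continuous for the weak, not the strong, operator topology; so the real part
    -- must be taken before passing to strong closure.
    have hc : Continuous fun T : H →WOT[ℂ] H => (2⁻¹ : ℂ) • (T + star T) :=
      Continuous.const_smul (continuous_id.add continuous_star_toWOT) (2⁻¹ : ℂ)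
    have h2 := map_mem_closure hc hh (t := toWOT A '' V) (by
      rintro _ ⟨m, hm, rfl⟩
      refine ⟨(2⁻¹ : ℂ) • (m + star m), ⟨SMulMemClass.smul_mem _ (add_mem hm (star_mem_adjoin hS hm)),
        ?_⟩, ?_⟩
      · rw [IsSelfAdjoint, star_smul, star_add, star_star, add_comm]
        simp
      · rw [map_smul, map_add, toWOT_star])
    rwa [← toWOT_star, hsa.star_eq, ← two_smul ℂ, smul_smul, inv_mul_cancel₀ two_ne_zero,
      one_smul] at h2
  have hconv : Convex ℝ (toWOT A '' V) := by
    rintro _ ⟨m, ⟨hm, hm'⟩, rfl⟩ _ ⟨k, ⟨hk, hk'⟩, rfl⟩ s t _ _ _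
    refine ⟨(s : ℂ) • m + (t : ℂ) • k, ⟨add_mem (SMulMemClass.smul_mem _ hm)
      (SMulMemClass.smul_mem _ hk), ?_⟩, ?_⟩
    · rw [IsSelfAdjoint, star_add, star_smul, star_smul, hm'.star_eq, hk'.star_eq]
      simp
    · rw [map_add, map_smul, map_smul]
      rfl
  rw [mem_closure_iff]
  intro U hU hhU
  obtain ⟨I, u, hu, hIU⟩ := isOpen_pi_iff.1 hU _ hhU
  classical
  let e : (H →WOT[ℂ] H) →ₗ[ℂ] (I → H) :=
    { toFun := fun T i => T i
      map_add' := fun _ _ => rfl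
      map_smul' := fun _ _ => rfl }
  -- Hahn–Banach for convex sets: evaluation at finitely many vectors is weakly continuous, so weak
  -- approximation gives norm approximation at those vectors.
  have he := LinearMap.image_closure_of_convex (𝕜 := ℂ) hconv e (by
    intro f
    have : ∀ T : H →WOT[ℂ] H, e.dualMap f T =
        ∑ i : I, (f.comp (ContinuousLinearMap.single ℂ (fun _ : I => H) i)) (T i) := by
      intro T
      exact (ContinuousLinearMap.sum_comp_single (R := ℂ) (φ := fun _ => H) f
        (fun i : I => T i)).symm
    refine Continuous.congr ?_ fun T => (this T).symm
    exact continuous_finsetSum _ fun i _ =>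
      ContinuousLinearMapWOT.continuous_dual_apply (i : H) _)
  have h3 := he ⟨_, h1, rfl⟩
  rw [mem_closure_iff] at h3
  obtain ⟨_, hy, _, ⟨m, hm, rfl⟩, rfl⟩ := h3 (Set.univ.pi fun i : I => u i)
    (isOpen_set_pi Set.finite_univ fun i _ => (hu i i.2).1) (fun i _ => (hu i i.2).2)
  exact ⟨_, hIU fun i hi => hy ⟨i, hi⟩ trivial, m, hm, rfl⟩

end WeakOperatorTopology

end BoolDeFinetti

namespace BoolDeFinetti

attribute [local instance] isClosed_toStarSubalgebra

open Filter

/-! ### The bounded transform `a (a + i)⁻¹` of selfadjoint elements. -/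

section Resolvent

variable {B : Type*} [CStarAlgebra B]

/-- The resolvent `(a + i)⁻¹` of a selfadjoint element. -/
noncomputable def resolventI (a : B) : B := cfc (fun z : ℂ => (z + Complex.I)⁻¹) a

theorem one_le_norm_add_I {a : B} (ha : IsSelfAdjoint a) {z : ℂ} (hz : z ∈ spectrum ℂ a) :
    1 ≤ ‖z + Complex.I‖ := by
  have h : (z + Complex.I).im = 1 := by
    rw [ha.mem_spectrum_eq_re hz]
    simp
  calc (1 : ℝ) = |(z + Complex.I).im| := by rw [h, abs_one]
    _ ≤ _ := Complex.abs_im_le_norm _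

theorem add_I_ne_zero {a : B} (ha : IsSelfAdjoint a) {z : ℂ} (hz : z ∈ spectrum ℂ a) :
    z + Complex.I ≠ 0 := by
  intro h
  have := one_le_norm_add_I ha hz
  rw [h, norm_zero] at this
  linarith

theorem continuousOn_inv_add_I {a : B} (ha : IsSelfAdjoint a) :
    ContinuousOn (fun z : ℂ => (z + Complex.I)⁻¹) (spectrum ℂ a) :=
  ContinuousOn.inv₀ (by fun_prop) fun _ hz => add_I_ne_zero ha hz

theorem norm_resolventI_le {a : B} (ha : IsSelfAdjoint a) : ‖resolventI a‖ ≤ 1 := by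
  refine norm_cfc_le zero_le_one fun z hz => ?_
  rw [norm_inv]
  exact inv_le_one_of_one_le₀ (one_le_norm_add_I ha hz)

theorem mul_resolventI {a : B} (ha : IsSelfAdjoint a) :
    a * resolventI a = 1 - Complex.I • resolventI a := by
  have hn : IsStarNormal a := ha.isStarNormal
  have hc := continuousOn_inv_add_I ha
  have h1 : a * resolventI a = cfc (fun z : ℂ => z * (z + Complex.I)⁻¹) a := by
    rw [cfc_mul (fun z : ℂ => z) (fun z : ℂ => (z + Complex.I)⁻¹) a (by fun_prop) hc, cfc_id' ℂ a]
    rfl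
  have h2 : cfc (fun z : ℂ => 1 - Complex.I • (z + Complex.I)⁻¹) a =
      1 - Complex.I • resolventI a := by
    rw [cfc_sub (fun _ : ℂ => (1 : ℂ)) (fun z : ℂ => Complex.I • (z + Complex.I)⁻¹) a (by fun_prop)
      (ContinuousOn.const_smul hc Complex.I), cfc_const_one ℂ a, cfc_smul Complex.I (fun z : ℂ => (z + Complex.I)⁻¹) a hc]
    rfl
  rw [h1, ← h2]
  refine cfc_congr fun z hz => ?_
  have := add_I_ne_zero ha hz
  simp only [smul_eq_mul]
  field_simp
  ring

theorem commute_resolventI {a : B} (ha : IsSelfAdjoint a) :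
    a * resolventI a = resolventI a * a := by
  have hn : IsStarNormal a := ha.isStarNormal
  have := cfc_commute_cfc (fun z : ℂ => z) (fun z : ℂ => (z + Complex.I)⁻¹) a
  rw [cfc_id' ℂ a] at this
  exact this

/-- The subalgebra need not contain `1`, so the resolvent itself may lie outside it. The function `z
/ (z + i)` vanishes at `0`, which puts it within the non-unital functional calculus. -/
theorem mul_resolventI_mem (s : NonUnitalStarSubalgebra ℂ B) [IsClosed (s : Set B)] {a : B}
    (ha : IsSelfAdjoint a) (has : a ∈ s) : a * resolventI a ∈ s := by
  have hn : IsStarNormal a := ha.isStarNormal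
  have hc := continuousOn_inv_add_I ha
  have h1 : a * resolventI a = cfcₙ (fun z : ℂ => z * (z + Complex.I)⁻¹) a := by
    rw [cfcₙ_eq_cfc (hf := ?_) (hf0 := by simp),
      cfc_mul (fun z : ℂ => z) (fun z : ℂ => (z + Complex.I)⁻¹) a (by fun_prop) hc, cfc_id' ℂ a]
    · rfl
    · refine ContinuousOn.mul continuousOn_id (ContinuousOn.inv₀ (by fun_prop) fun z hz => ?_)
      rw [quasispectrum_eq_spectrum_union_zero] at hz
      rcases hz with hz | hz
      · exact add_I_ne_zero ha hz
      · rw [Set.mem_singleton_iff.1 hz, zero_add]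
        exact Complex.I_ne_zero
  rw [h1]
  exact cfcₙ_mem _ has

/-- The resolvent identity; it makes the bounded transform strongly continuous on selfadjoint
elements without any bound on them. -/
theorem resolventI_sub {a b : B} (ha : IsSelfAdjoint a) (hb : IsSelfAdjoint b) :
    resolventI a - resolventI b = resolventI a * (b - a) * resolventI b := by
  have h1 := mul_resolventI hb
  have h2 := mul_resolventI ha
  rw [commute_resolventI ha] at h2
  rw [mul_sub, sub_mul, mul_assoc, h1, h2]
  simp [mul_sub, sub_mul]

theorem norm_mul_resolventI_le {a : B} (ha : IsSelfAdjoint a) : ‖a * resolventI a‖ ≤ 2 := by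
  rcases subsingleton_or_nontrivial B with h | h
  · rw [Subsingleton.elim (a * resolventI a) 0, norm_zero]
    exact zero_le_two
  · rw [mul_resolventI ha]
    calc ‖1 - Complex.I • resolventI a‖ ≤ ‖(1 : B)‖ + ‖Complex.I • resolventI a‖ := norm_sub_le _ _
      _ ≤ 1 + 1 := by
        rw [norm_smul, Complex.norm_I, one_mul, CStarRing.norm_one]
        gcongr
        exact norm_resolventI_le ha
      _ = 2 := by norm_num

/-- `(δ a + i)⁻¹ → -i` for `δ → 0`. -/
theorem norm_I_smul_resolventI_sub_one_le {a : B} (ha : IsSelfAdjoint a) (δ : ℝ) :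
    ‖Complex.I • resolventI ((δ : ℂ) • a) - 1‖ ≤ |δ| * ‖a‖ := by
  have hδ : IsSelfAdjoint ((δ : ℂ) • a) := by
    rw [IsSelfAdjoint, star_smul, ha.star_eq]
    simp
  have h := mul_resolventI hδ
  have : Complex.I • resolventI ((δ : ℂ) • a) - 1 = -((δ : ℂ) • a * resolventI ((δ : ℂ) • a)) := by
    rw [h]; abel
  rw [this, norm_neg]
  calc _ ≤ ‖(δ : ℂ) • a‖ * ‖resolventI ((δ : ℂ) • a)‖ := norm_mul_le _ _
    _ ≤ ‖(δ : ℂ) • a‖ * 1 := by gcongr; exact norm_resolventI_le hδ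
    _ = _ := by rw [mul_one, norm_smul]; simp

end Resolvent

/-! ### Bounded approximation in weak closures. -/

section Density

variable {H : Type*} [NormedAddCommGroup H] [InnerProductSpace ℂ H] [CompleteSpace H]
  {A : VonNeumannAlgebra H}

/-- A subspace of a von Neumann algebra is boundedly closed if it contains the limits of its bounded
nets in the weak operator topology. -/
def BoundedlyClosed (R : Submodule ℂ A.toStarSubalgebra) : Prop :=
  ∀ (F : Filter A.toStarSubalgebra) [F.NeBot] (r : ℝ) (b : A.toStarSubalgebra),
    (∀ᶠ a in F, ‖a‖ ≤ r) → (∀ᶠ a in F, a ∈ R) → Tendsto (toWOT A) F (𝓝 (toWOT A b)) → b ∈ R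

theorem BoundedlyClosed.mem_of_tendsto_toWOT {R : Submodule ℂ A.toStarSubalgebra}
    (hR : BoundedlyClosed R) {ι : Type*} {F : Filter ι} [F.NeBot] {r : ℝ}
    {a : ι → A.toStarSubalgebra} {b : A.toStarSubalgebra} (hr : ∀ᶠ i in F, ‖a i‖ ≤ r)
    (ha : ∀ᶠ i in F, a i ∈ R) (hb : Tendsto (fun i => toWOT A (a i)) F (𝓝 (toWOT A b))) : b ∈ R :=
  hR (F.map a) r b hr ha (tendsto_map'_iff.2 hb)

theorem BoundedlyClosed.mem_of_tendsto {R : Submodule ℂ A.toStarSubalgebra}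
    (hR : BoundedlyClosed R) {ι : Type*} {F : Filter ι} [F.NeBot]
    {a : ι → A.toStarSubalgebra} {b : A.toStarSubalgebra}
    (ha : ∀ᶠ i in F, a i ∈ R) (hb : Tendsto a F (𝓝 b)) : b ∈ R := by
  refine hR.mem_of_tendsto_toWOT (r := ‖b‖ + 1) ?_ ha (tendsto_toWOT_of_tendsto hb)
  exact (hb.norm.eventually_lt_const (lt_add_one _)).mono fun _ h => h.le

/-- A boundedly closed subspace which contains the algebra generated by a set of selfadjoint elements
contains its closure in the weak operator topology. -/
theorem BoundedlyClosed.wotAlg_le {R : Submodule ℂ A.toStarSubalgebra} (hR : BoundedlyClosed R)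
    {S : Set A.toStarSubalgebra} (hS : ∀ s ∈ S, IsSelfAdjoint s)
    (hSR : ∀ a ∈ NonUnitalAlgebra.adjoin ℂ S, a ∈ R) {a : A.toStarSubalgebra} (ha : a ∈ wotAlg S) :
    a ∈ R := by
  let M : NonUnitalStarSubalgebra ℂ A.toStarSubalgebra :=
    { NonUnitalAlgebra.adjoin ℂ S with star_mem' := star_mem_adjoin hS }
  have hM : ∀ m ∈ M.topologicalClosure, m ∈ R := by
    intro m hm
    obtain ⟨u, hu, hum⟩ := mem_closure_iff_seq_limit.1 (show m ∈ closure (M : Set _) from hm)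
    exact hR.mem_of_tendsto (Eventually.of_forall fun n => hSR _ (hu n)) hum
  have : IsClosed (M.topologicalClosure : Set A.toStarSubalgebra) := isClosed_closure
  -- Approximants `m` of `h` may be unbounded, but their transforms `m (m + i)⁻¹` have norm at most
  -- `2` and lie in the norm closure of the algebra.
  have key : ∀ h ∈ wotAlg S, IsSelfAdjoint h → h * resolventI h ∈ R := by
    intro h hh hsa
    have hcl := mem_closure_selfAdjoint hS hsa hh
    set V : Set A.toStarSubalgebra := {m | m ∈ NonUnitalAlgebra.adjoin ℂ S ∧ IsSelfAdjoint m}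
    let g : A.toStarSubalgebra → H → H := fun a => ((a : H →L[ℂ] H) : H → H)
    -- The filter of strong neighbourhoods of `h`, traced on the selfadjoint part of the algebra.
    let F : Filter A.toStarSubalgebra := comap g (𝓝 (g h)) ⊓ 𝓟 V
    have : F.NeBot := by
      refine inf_principal_neBot_iff.2 fun U hU => ?_
      obtain ⟨t, ht, htU⟩ := hU
      obtain ⟨_, hy, m, hm, rfl⟩ := mem_closure_iff_nhds.1 hcl t ht
      exact ⟨m, htU hy, hm⟩
    have hg : Tendsto g F (𝓝 (g h)) := tendsto_comap.mono_left inf_le_left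
    have hV : ∀ᶠ m in F, m ∈ V := mem_inf_of_right (mem_principal_self _)
    refine hR.mem_of_tendsto_toWOT (F := F) (r := 2) (a := fun m => m * resolventI m) ?_ ?_ ?_
    · filter_upwards [hV] with m hm using norm_mul_resolventI_le hm.2
    · filter_upwards [hV] with m hm
      exact hM _ (mul_resolventI_mem _ hm.2 (subset_closure hm.1))
    · rw [tendsto_toWOT_iff]
      intro ξ η
      refine Tendsto.inner tendsto_const_nhds ?_
      rw [tendsto_iff_norm_sub_tendsto_zero]
      have h0 : Tendsto (fun m : A.toStarSubalgebra =>
          ‖((m : H →L[ℂ] H) - h) (((resolventI h : A.toStarSubalgebra) : H →L[ℂ] H) ξ)‖) F (𝓝 0) := by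
        have := (tendsto_pi_nhds.1 hg) (((resolventI h : A.toStarSubalgebra) : H →L[ℂ] H) ξ)
        exact tendsto_iff_norm_sub_tendsto_zero.1 this
      refine squeeze_zero' (Eventually.of_forall fun _ => norm_nonneg _) ?_ h0
      filter_upwards [hV] with m hm
      -- In this form `m - h` acts on the fixed vector `(h + i)⁻¹ ξ`, with a contraction to its
      -- left; strong convergence of `m` to `h` is enough.
      have h2 : m * resolventI m - h * resolventI h =
          Complex.I • (resolventI m * (m - h) * resolventI h) := by
        have h3 := resolventI_sub hm.2 hsa
        rw [mul_resolventI hm.2, mul_resolventI hsa]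
        have h4 : resolventI m * (m - h) * resolventI h =
            -(resolventI m * (h - m) * resolventI h) := by noncomm_ring
        rw [h4, ← h3, smul_neg, smul_sub]
        abel
      have h5 : ((m * resolventI m : A.toStarSubalgebra) : H →L[ℂ] H) ξ -
          ((h * resolventI h : A.toStarSubalgebra) : H →L[ℂ] H) ξ =
          Complex.I • ((resolventI m : A.toStarSubalgebra) : H →L[ℂ] H)
            (((m : H →L[ℂ] H) - h) (((resolventI h : A.toStarSubalgebra) : H →L[ℂ] H) ξ)) :=
        congrArg (fun a : A.toStarSubalgebra => (a : H →L[ℂ] H) ξ) h2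
      rw [h5, norm_smul, Complex.norm_I, one_mul]
      calc _ ≤ 1 * _ := ContinuousLinearMap.le_of_opNorm_le _ (norm_resolventI_le hm.2) _
        _ = _ := one_mul _
  have key2 : ∀ h ∈ wotAlg S, IsSelfAdjoint h → h ∈ R := by
    intro h hh hsa
    -- The transform is undone by rescaling: `i (δ h + i)⁻¹` tends to `1` in norm as `δ → 0`.
    have ht : Tendsto (fun δ : ℝ => (Complex.I / δ) • (((δ : ℂ) • h) * resolventI ((δ : ℂ) • h)))
        (𝓝[≠] 0) (𝓝 h) := by
      rw [tendsto_iff_norm_sub_tendsto_zero]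
      have h0 : Tendsto (fun δ : ℝ => ‖h‖ * (|δ| * ‖h‖)) (𝓝[≠] 0) (𝓝 0) := by
        have : Tendsto (fun δ : ℝ => ‖h‖ * (|δ| * ‖h‖)) (𝓝 0) (𝓝 (‖h‖ * (|0| * ‖h‖))) :=
          Continuous.tendsto (by fun_prop) 0
        simp only [abs_zero, zero_mul, mul_zero] at this
        exact this.mono_left nhdsWithin_le_nhds
      refine squeeze_zero' (Eventually.of_forall fun _ => norm_nonneg _) ?_ h0
      filter_upwards [self_mem_nhdsWithin] with δ hδ
      have hδ' : (δ : ℂ) ≠ 0 := by exact_mod_cast hδ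
      have h1 : (Complex.I / δ) • (((δ : ℂ) • h) * resolventI ((δ : ℂ) • h)) - h =
          h * (Complex.I • resolventI ((δ : ℂ) • h) - 1) := by
        rw [smul_mul_assoc, smul_smul, div_mul_cancel₀ _ hδ', mul_sub, mul_one, mul_smul_comm]
      rw [h1]
      exact (norm_mul_le _ _).trans (by gcongr; exact norm_I_smul_resolventI_sub_one_le hsa δ)
    refine hR.mem_of_tendsto (Eventually.of_forall fun δ => R.smul_mem _ (key _ ?_ ?_)) ht
    · exact SMulMemClass.smul_mem _ hh
    · rw [IsSelfAdjoint, star_smul, hsa.star_eq]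
      simp
  have hs := star_mem_wotAlg hS ha
  have ha' : a = (2⁻¹ : ℂ) • (a + star a) + (-Complex.I / 2) • (Complex.I • (a - star a)) := by
    rw [smul_smul]
    have : -Complex.I / 2 * Complex.I = 2⁻¹ := by
      linear_combination (-2⁻¹ : ℂ) * Complex.I_mul_I
    rw [this, ← smul_add, add_add_sub_cancel, ← two_smul ℂ, smul_smul, inv_mul_cancel₀ two_ne_zero,
      one_smul]
  rw [ha']
  refine R.add_mem (R.smul_mem _ (key2 _ (add_mem ha hs) ?_))
    (R.smul_mem _ (key2 _ (SMulMemClass.smul_mem _ (sub_mem ha hs)) ?_))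
  · rw [IsSelfAdjoint, star_add, star_star, add_comm]
  · rw [IsSelfAdjoint, star_smul, star_sub, star_star, Complex.star_def, Complex.conj_I, neg_smul,
      ← smul_neg, neg_sub]

end Density

end BoolDeFinetti

namespace BoolDeFinetti

attribute [local instance] isClosed_toStarSubalgebra

open Filter

/-! ### Cyclic representations -/

section Dense

variable {K : Type*} [NormedAddCommGroup K] [InnerProductSpace ℂ K]

theorem tendsto_zero_of_dense {ι : Type*} {F : Filter ι} {f : ι → StrongDual ℂ K} {r : ℝ}
    (hr : ∀ᶠ i in F, ‖f i‖ ≤ r) {D : Set K} (hD : (Submodule.span ℂ D).topologicalClosure = ⊤)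
    (h : ∀ ζ ∈ D, Tendsto (fun i => f i ζ) F (𝓝 0)) (ζ : K) :
    Tendsto (fun i => f i ζ) F (𝓝 0) := by
  have hs : ∀ ζ ∈ Submodule.span ℂ D, Tendsto (fun i => f i ζ) F (𝓝 0) := by
    intro ζ hζ
    induction hζ using Submodule.span_induction with
    | mem ζ hζ => exact h ζ hζ
    | zero => simpa using tendsto_const_nhds
    | add ζ ζ' _ _ h1 h2 => simpa using h1.add h2
    | smul c ζ _ h1 => simpa using h1.const_mul c
  rw [Metric.tendsto_nhds]
  intro ε hε
  have hζ : ζ ∈ closure (Submodule.span ℂ D : Set K) := by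
    rw [← Submodule.topologicalClosure_coe, hD]; trivial
  -- `|r| + 1` is a positive bound for the norms even when `r` is not positive, so the error from
  -- replacing `ζ` by `ζ'` is at most `ε / 2`.
  obtain ⟨ζ', hζ', hd⟩ := Metric.mem_closure_iff.1 hζ (ε / (2 * (|r| + 1))) (by positivity)
  have h1 := Metric.tendsto_nhds.1 (hs ζ' hζ') (ε / 2) (by positivity)
  filter_upwards [hr, h1] with i hi h2
  rw [dist_zero_right] at h2 ⊢
  have h3 : ‖f i (ζ - ζ')‖ ≤ (|r| + 1) * (ε / (2 * (|r| + 1))) := by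
    rw [dist_eq_norm] at hd
    calc _ ≤ ‖f i‖ * ‖ζ - ζ'‖ := (f i).le_opNorm _
      _ ≤ _ := by
        gcongr
        exact hi.trans ((le_abs_self r).trans (lt_add_one _).le)
  have h4 : (|r| + 1) * (ε / (2 * (|r| + 1))) = ε / 2 := by
    field_simp
  calc ‖f i ζ‖ = ‖f i (ζ - ζ') + f i ζ'‖ := by rw [map_sub, sub_add_cancel]
    _ ≤ _ := norm_add_le _ _
    _ < ε := by linarith

/-- Weak convergence of a bounded net of operators can be tested on a total set of vectors. -/
theorem tendsto_inner_of_dense {ι : Type*} {F : Filter ι} {T : ι → K →L[ℂ] K} {S : K →L[ℂ] K}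
    {r : ℝ} (hr : ∀ᶠ i in F, ‖T i‖ ≤ r) {D : Set K}
    (hD : (Submodule.span ℂ D).topologicalClosure = ⊤)
    (h : ∀ η ∈ D, ∀ ζ ∈ D, Tendsto (fun i => ⟪η, T i ζ⟫_ℂ) F (𝓝 ⟪η, S ζ⟫_ℂ)) (η ζ : K) :
    Tendsto (fun i => ⟪η, T i ζ⟫_ℂ) F (𝓝 ⟪η, S ζ⟫_ℂ) := by
  have hr' : ∀ᶠ i in F, ‖T i - S‖ ≤ r + ‖S‖ :=
    hr.mono fun i hi => (norm_sub_le _ _).trans (by gcongr)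
  have h1 : ∀ η ∈ D, ∀ ζ, Tendsto (fun i => ⟪η, (T i - S) ζ⟫_ℂ) F (𝓝 0) := by
    intro η hη
    refine tendsto_zero_of_dense (f := fun i => (innerSL ℂ η).comp (T i - S))
      (r := ‖η‖ * (r + ‖S‖)) ?_ hD ?_
    · filter_upwards [hr'] with i hi
      refine (ContinuousLinearMap.opNorm_comp_le _ _).trans ?_
      rw [innerSL_apply_norm]
      gcongr
    · intro ζ hζ
      simpa [inner_sub_right] using (h η hη ζ hζ).sub_const ⟪η, S ζ⟫_ℂ
  have h2 : Tendsto (fun i => ⟪(T i - S) ζ, η⟫_ℂ) F (𝓝 0) := by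
    refine tendsto_zero_of_dense (f := fun i => innerSL ℂ ((T i - S) ζ))
      (r := (r + ‖S‖) * ‖ζ‖) ?_ hD ?_ η
    · filter_upwards [hr'] with i hi
      rw [innerSL_apply_norm]
      exact ContinuousLinearMap.le_of_opNorm_le _ hi _
    · intro η hη
      have := (Complex.continuous_conj.tendsto _).comp (h1 η hη ζ)
      simpa [Function.comp_def] using this
  have h3 := (Complex.continuous_conj.tendsto _).comp h2
  simp only [Function.comp_def, inner_conj_symm, map_zero] at h3
  have h4 := h3.add_const ⟪η, S ζ⟫_ℂ
  simpa [inner_sub_right] using h4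

end Dense

/-- `π` is a cyclic representation with cyclic vector `Ω` implementing `φ`. -/
structure IsGNS {B : Type*} [CStarAlgebra B] {K : Type*} [NormedAddCommGroup K]
    [InnerProductSpace ℂ K] [CompleteSpace K] (φ : B →ₗ[ℂ] ℂ) (π : B →⋆ₐ[ℂ] (K →L[ℂ] K))
    (Ω : K) : Prop where
  apply_eq : ∀ a, φ a = ⟪Ω, π a Ω⟫_ℂ
  dense : DenseRange fun a => π a Ω

universe u in
/-- The Gelfand–Naimark–Segal construction. -/
theorem exists_isGNS {B : Type u} [CStarAlgebra B] (φ : B →ₗ[ℂ] ℂ)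
    (hφ : ∀ a, 0 ≤ φ (star a * a)) :
    ∃ (K : Type u) (_ : NormedAddCommGroup K) (_ : InnerProductSpace ℂ K) (_ : CompleteSpace K)
      (π : B →⋆ₐ[ℂ] (K →L[ℂ] K)) (Ω : K), IsGNS φ π Ω := by
  let _ := CStarAlgebra.spectralOrder B
  let _ := CStarAlgebra.spectralOrderedRing B
  let f : B →ₚ[ℂ] ℂ := PositiveLinearMap.mk₀ φ fun a ha => by
    obtain ⟨b, rfl⟩ := CStarAlgebra.nonneg_iff_eq_star_mul_self.1 ha
    exact hφ b
  have hf : ∀ a, f a = φ a := fun _ => rfl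
  have happ : ∀ a, f.gnsStarAlgHom a ((f.toPreGNS 1 : f.PreGNS) : f.GNS) =
      ((f.toPreGNS a : f.PreGNS) : f.GNS) := by
    intro a
    refine f.gnsNonUnitalStarAlgHom_apply_coe.trans ?_
    simp
  refine ⟨f.GNS, inferInstance, inferInstance, inferInstance, f.gnsStarAlgHom,
    ((f.toPreGNS 1 : f.PreGNS) : f.GNS), ⟨fun a => ?_, ?_⟩⟩
  · rw [happ, UniformSpace.Completion.inner_coe, PositiveLinearMap.preGNS_inner_def]
    simp [hf]
  · have h1 : (fun a => f.gnsStarAlgHom a ((f.toPreGNS 1 : f.PreGNS) : f.GNS)) =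
        (fun b : f.PreGNS => (b : f.GNS)) ∘ f.toPreGNS := funext happ
    rw [h1]
    exact UniformSpace.Completion.denseRange_coe.comp f.toPreGNS.surjective.denseRange
      (UniformSpace.Completion.continuous_coe _)

/-! ### Faithfulness and normality of the cyclic representation. -/

section Representation

variable {H : Type*} [NormedAddCommGroup H] [InnerProductSpace ℂ H] [CompleteSpace H]
  {A : VonNeumannAlgebra H} {K : Type*} [NormedAddCommGroup K] [InnerProductSpace ℂ K]
  [CompleteSpace K] {φ : A.toStarSubalgebra →ₗ[ℂ] ℂ}
  {π : A.toStarSubalgebra →⋆ₐ[ℂ] (K →L[ℂ] K)} {Ω : K}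

theorem inner_rep_left (π : A.toStarSubalgebra →⋆ₐ[ℂ] (K →L[ℂ] K)) (a : A.toStarSubalgebra)
    (η ζ : K) : ⟪π a η, ζ⟫_ℂ = ⟪η, π (star a) ζ⟫_ℂ := by
  rw [map_star, ContinuousLinearMap.star_eq_adjoint, ContinuousLinearMap.adjoint_inner_right]

namespace IsGNS

theorem inner_eq (h : IsGNS φ π Ω) (a b c : A.toStarSubalgebra) :
    ⟪π a Ω, π b (π c Ω)⟫_ℂ = φ (star a * b * c) := by
  rw [inner_rep_left, h.apply_eq, mul_assoc, map_mul, map_mul]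
  rfl

theorem span_dense (h : IsGNS φ π Ω) :
    (Submodule.span ℂ (Set.range fun a => π a Ω)).topologicalClosure = ⊤ := by
  rw [← Submodule.dense_iff_topologicalClosure_eq_top]
  exact h.dense.mono Submodule.subset_span

theorem ext_dense {η : K} (h : IsGNS φ π Ω) (hη : ∀ a, ⟪η, π a Ω⟫_ℂ = 0) : η = 0 := by
  have h1 : (fun ζ => ⟪η, ζ⟫_ℂ) = fun _ => 0 := by
    refine h.dense.equalizer (by fun_prop) continuous_const ?_
    exact funext hη
  exact inner_self_eq_zero.1 (congrFun h1 η)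

/-- The numbers `φ(b a c)` are matrix coefficients of `π a`, so they all vanish when `π a = 0`. -/
theorem injective (h : IsGNS φ π Ω) (hnd : NonDegenerated φ) : Function.Injective π := by
  rw [injective_iff_map_eq_zero]
  intro a ha
  refine hnd a fun b c => ?_
  have := h.inner_eq (star b) a c
  rw [star_star] at this
  rw [← this, ha]
  simp

theorem tendsto_inner (h : IsGNS φ π Ω) (hφ : IsNormalFunctional φ) {ι : Type*} {F : Filter ι}
    {r : ℝ} {a : ι → A.toStarSubalgebra} {b : A.toStarSubalgebra} (hr : ∀ᶠ i in F, ‖a i‖ ≤ r)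
    (hb : Tendsto (fun i => toWOT A (a i)) F (𝓝 (toWOT A b))) (η ζ : K) :
    Tendsto (fun i => ⟪η, π (a i) ζ⟫_ℂ) F (𝓝 ⟪η, π b ζ⟫_ℂ) := by
  refine tendsto_inner_of_dense (r := r) ?_ h.span_dense ?_ η ζ
  · filter_upwards [hr] with i hi using (NonUnitalStarAlgHom.norm_apply_le π _).trans hi
  · rintro _ ⟨c, rfl⟩ _ ⟨d, rfl⟩
    simp_rw [h.inner_eq]
    refine hφ.tendsto (r := ‖star c‖ * r * ‖d‖) ?_ (tendsto_toWOT_mul_mul hb _ _)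
    filter_upwards [hr] with i hi
    calc _ ≤ ‖star c * a i‖ * ‖d‖ := norm_mul_le _ _
      _ ≤ ‖star c‖ * ‖a i‖ * ‖d‖ := by gcongr; exact norm_mul_le _ _
      _ ≤ _ := by gcongr

/-- The functional `a ↦ ⟪η, π a ζ⟫`. -/
noncomputable def vecFunctional (π : A.toStarSubalgebra →⋆ₐ[ℂ] (K →L[ℂ] K)) (η ζ : K) :
    A.toStarSubalgebra →ₗ[ℂ] ℂ where
  toFun a := ⟪η, π a ζ⟫_ℂ
  map_add' a b := by simp
  map_smul' c a := by simp

theorem isNormalFunctional_vecFunctional (h : IsGNS φ π Ω) (hφ : IsNormalFunctional φ) (η ζ : K) :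
    IsNormalFunctional (vecFunctional π η ζ) :=
  isNormalFunctional_iff.2 fun _ _ _ hF hb => h.tendsto_inner hφ (a := id) hF hb η ζ

/-- A bounded net whose image in a faithful normal cyclic representation converges weakly
converges in the weak operator topology. -/
theorem exists_tendsto (h : IsGNS φ π Ω) (hφ : IsNormalFunctional φ) (hπ : Function.Injective π)
    {ι : Type*} {F : Filter ι} [F.NeBot] {r : ℝ} {a : ι → A.toStarSubalgebra} {T : K →L[ℂ] K}
    (hr : ∀ᶠ i in F, ‖a i‖ ≤ r)
    (hT : ∀ η ζ, Tendsto (fun i => ⟪η, π (a i) ζ⟫_ℂ) F (𝓝 ⟪η, T ζ⟫_ℂ)) :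
    ∃ b, π b = T ∧ Tendsto (fun i => toWOT A (a i)) F (𝓝 (toWOT A b)) := by
  -- Bounded sets are weakly relatively compact, so every ultrafilter has a limit; each limit is
  -- mapped to `T`, and injectivity of `π` makes them all equal.
  have key : ∀ U : Ultrafilter ι, ↑U ≤ F →
      ∃ b, π b = T ∧ Tendsto (fun i => toWOT A (a i)) U (𝓝 (toWOT A b)) := by
    intro U hU
    obtain ⟨b, hb⟩ := exists_tendsto_toWOT U (hr.filter_mono hU)
    refine ⟨b, ?_, hb⟩
    ext1 ζ
    refine ext_inner_left ℂ fun η => ?_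
    exact tendsto_nhds_unique (h.tendsto_inner hφ (hr.filter_mono hU) hb η ζ)
      ((hT η ζ).mono_left hU)
  obtain ⟨b, hb, -⟩ := key (Ultrafilter.of F) (Ultrafilter.of_le F)
  refine ⟨b, hb, tendsto_iff_ultrafilter _ _ _ |>.2 fun U hU => ?_⟩
  obtain ⟨b', hb', ht⟩ := key U hU
  rwa [hπ (hb.trans hb'.symm)]

end IsGNS

theorem IsNormalFunctional.sub {ψ ψ' : A.toStarSubalgebra →ₗ[ℂ] ℂ} (h : IsNormalFunctional ψ)
    (h' : IsNormalFunctional ψ') : IsNormalFunctional (ψ - ψ') :=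
  isNormalFunctional_iff.2 fun _ _ _ hF hb =>
    (h.tendsto (a := id) hF hb).sub (h'.tendsto (a := id) hF hb)

/-- This is how equalities of normal functionals spread from words to the weak closure. -/
theorem IsNormalFunctional.boundedlyClosed_ker {ψ : A.toStarSubalgebra →ₗ[ℂ] ℂ}
    (h : IsNormalFunctional ψ) : BoundedlyClosed (LinearMap.ker ψ) := by
  intro F _ r b hF hR hb
  refine tendsto_nhds_unique (h.tendsto (a := id) hF hb) ?_
  exact tendsto_const_nhds.congr' (hR.mono fun a ha => (LinearMap.mem_ker.1 ha).symm)

end Representation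

end BoolDeFinetti

namespace BoolDeFinetti

attribute [local instance] isClosed_toStarSubalgebra

open Filter

/-! ### Words in a sequence -/

section Words

/-- The product `x_{i_1} ⋯ x_{i_k}`. -/
def word {B : Type*} [Monoid B] (x : ℕ → B) (w : List ℕ) : B := (w.map x).prod

/-- The word `(i_1 + N, …, i_k + N)`. -/
def shift (w : List ℕ) (N : ℕ) : List ℕ := w.map (· + N)

theorem shift_ne_nil {w : List ℕ} (h : w ≠ []) (N : ℕ) : shift w N ≠ [] := by
  simpa [shift] using h

theorem mem_shift_le {w : List ℕ} {N i : ℕ} (h : i ∈ shift w N) : N ≤ i := by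
  obtain ⟨j, -, rfl⟩ := List.mem_map.1 h
  exact Nat.le_add_left _ _

theorem mem_shift_lt {w : List ℕ} {N M i : ℕ} (hw : ∀ j ∈ w, j < N) (h : i ∈ shift w M) :
    i < N + M := by
  obtain ⟨j, hj, rfl⟩ := List.mem_map.1 h
  exact Nat.add_lt_add_right (hw j hj) M

theorem length_shift (w : List ℕ) (N : ℕ) : (shift w N).length = w.length := List.length_map _

theorem shift_reverse (w : List ℕ) (N : ℕ) : (shift w N).reverse = shift w.reverse N := by
  simp [shift]

theorem samePattern_shift_shift (w : List ℕ) (N M : ℕ) : SamePattern (shift w N) (shift w M) :=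
  SamePattern.map_map (add_left_injective N) (add_left_injective M) w

theorem samePattern_shift (w : List ℕ) (N : ℕ) : SamePattern w (shift w N) :=
  SamePattern.map (add_left_injective N) w

theorem samePattern_shift_left (w : List ℕ) (N : ℕ) : SamePattern (shift w N) w := by
  simpa [shift] using SamePattern.map_map (add_left_injective N) Function.injective_id w

theorem exists_lt (w : List ℕ) : ∃ N, ∀ i ∈ w, i < N := by
  obtain ⟨m, hm⟩ := w.toFinset.bddAbove
  exact ⟨m + 1, fun i hi => Nat.lt_succ_of_le (hm (by simpa using hi))⟩

section Monoid

variable {B : Type*} [Monoid B] (x : ℕ → B)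

theorem word_append (u v : List ℕ) : word x (u ++ v) = word x u * word x v := by
  simp [word]

theorem word_cons (i : ℕ) (v : List ℕ) : word x (i :: v) = x i * word x v := by
  simp [word]

theorem word_nil : word x [] = 1 := rfl

theorem star_word [StarMul B] (hx : ∀ i, IsSelfAdjoint (x i)) (w : List ℕ) :
    star (word x w) = word x w.reverse := by
  induction w with
  | nil => simp [word]
  | cons i w ih =>
    rw [word_cons, star_mul, ih, (hx i).star_eq, List.reverse_cons, word_append]
    simp [word]

end Monoid

variable {B : Type*} [Ring B] [Algebra ℂ B] (x : ℕ → B)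

theorem word_mem_adjoin {I : Set ℕ} {w : List ℕ} (hw : w ≠ []) (hI : ∀ i ∈ w, i ∈ I) :
    word x w ∈ NonUnitalAlgebra.adjoin ℂ (x '' I) := by
  induction w with
  | nil => exact absurd rfl hw
  | cons i w ih =>
    have hi : x i ∈ NonUnitalAlgebra.adjoin ℂ (x '' I) :=
      NonUnitalAlgebra.subset_adjoin ℂ ⟨i, hI i (by simp), rfl⟩
    rw [word_cons]
    rcases eq_or_ne w [] with rfl | hw'
    · simpa [word_nil] using hi
    · exact mul_mem hi (ih hw' fun j hj => hI j (by simp [hj]))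

theorem adjoin_le_span_word (I : Set ℕ) {a : B} (ha : a ∈ NonUnitalAlgebra.adjoin ℂ (x '' I)) :
    a ∈ Submodule.span ℂ (word x '' {w | w ≠ [] ∧ ∀ i ∈ w, i ∈ I}) := by
  have h : a ∈ (NonUnitalAlgebra.adjoin ℂ (x '' I)).toSubmodule := ha
  rw [NonUnitalAlgebra.adjoin_eq_span] at h
  refine Submodule.span_mono ?_ h
  intro b hb
  induction hb using Subsemigroup.closure_induction with
  | mem b hb =>
    obtain ⟨i, hi, rfl⟩ := hb
    exact ⟨[i], ⟨by simp, by simpa using hi⟩, by simp [word]⟩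
  | mul b c _ _ hb hc =>
    obtain ⟨u, ⟨hu, hu'⟩, rfl⟩ := hb
    obtain ⟨v, ⟨hv, hv'⟩, rfl⟩ := hc
    refine ⟨u ++ v, ⟨by simp [hu], fun i hi => ?_⟩, word_append x u v⟩
    rcases List.mem_append.1 hi with h | h
    · exact hu' i h
    · exact hv' i h

end Words

/-- Equal Gram matrices give equal norms of all linear combinations. -/
theorem norm_linearCombination_eq {ι K : Type*} [NormedAddCommGroup K] [InnerProductSpace ℂ K]
    {f g : ι → K} (h : ∀ i j, ⟪f i, f j⟫_ℂ = ⟪g i, g j⟫_ℂ) (c : ι →₀ ℂ) :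
    ‖Finsupp.linearCombination ℂ f c‖ = ‖Finsupp.linearCombination ℂ g c‖ := by
  have h1 : ⟪Finsupp.linearCombination ℂ f c, Finsupp.linearCombination ℂ f c⟫_ℂ =
      ⟪Finsupp.linearCombination ℂ g c, Finsupp.linearCombination ℂ g c⟫_ℂ := by
    simp only [Finsupp.linearCombination_apply, Finsupp.sum, sum_inner, inner_sum, inner_smul_left,
      inner_smul_right, h]
  rw [@norm_eq_sqrt_re_inner ℂ, h1, ← @norm_eq_sqrt_re_inner ℂ]

/-! ### Boolean invariant sequences in a cyclic representation -/

section Setting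

variable {H : Type*} [NormedAddCommGroup H] [InnerProductSpace ℂ H] [CompleteSpace H]
  {A : VonNeumannAlgebra H} {K : Type*} [NormedAddCommGroup K] [InnerProductSpace ℂ K]
  [CompleteSpace K] {φ : A.toStarSubalgebra →ₗ[ℂ] ℂ} {x : ℕ → A.toStarSubalgebra}
  {π : A.toStarSubalgebra →⋆ₐ[ℂ] (K →L[ℂ] K)} {Ω : K}

/-- The sequence `x` of selfadjoint elements generates `A` and is boolean invariant with respect to
the normal functional `φ`, whose cyclic representation `π` is faithful. -/
structure IsBooleanSystem (φ : A.toStarSubalgebra →ₗ[ℂ] ℂ) (x : ℕ → A.toStarSubalgebra)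
    (π : A.toStarSubalgebra →⋆ₐ[ℂ] (K →L[ℂ] K)) (Ω : K) : Prop where
  gns : IsGNS φ π Ω
  injective : Function.Injective π
  normal : IsNormalFunctional φ
  selfAdjoint : ∀ i, IsSelfAdjoint (x i)
  generates : wotAlg (Set.range x) = ⊤
  invariant : BooleanInvariant φ x

variable (x) in
/-- The limit of the shifted words `x_{i_1 + N} ⋯ x_{i_k + N}` in the weak operator topology. -/
noncomputable def limWord (w : List ℕ) : A.toStarSubalgebra :=
  open Classical in
  if h : ∃ e, Tendsto (fun N => toWOT A (word x (shift w N))) atTop (𝓝 (toWOT A e)) then h.choose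
  else 0

namespace IsBooleanSystem

variable (hS : IsBooleanSystem φ x π Ω)
include hS

theorem moment_congr {w w' : List ℕ} (h : SamePattern w w') : φ (word x w) = φ (word x w') :=
  hS.invariant.moment_congr h

theorem inner_word (u w v : List ℕ) :
    ⟪π (word x u) Ω, π (word x w) (π (word x v) Ω)⟫_ℂ = φ (word x (u.reverse ++ (w ++ v))) := by
  rw [hS.gns.inner_eq, star_word x hS.selfAdjoint, word_append, word_append, mul_assoc]

theorem inner_word_word (u v : List ℕ) :
    ⟪π (word x u) Ω, π (word x v) Ω⟫_ℂ = φ (word x (u.reverse ++ v)) := by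
  simpa [word_nil] using hS.inner_word u [] v

theorem mem_of_boundedlyClosed {R : Submodule ℂ A.toStarSubalgebra} (hR : BoundedlyClosed R)
    {I : Set ℕ} (h : ∀ w, w ≠ [] → (∀ i ∈ w, i ∈ I) → word x w ∈ R) {a : A.toStarSubalgebra}
    (ha : a ∈ wotAlg (x '' I)) : a ∈ R := by
  refine hR.wotAlg_le ?_ (fun b hb => ?_) ha
  · rintro _ ⟨i, -, rfl⟩
    exact hS.selfAdjoint i
  · refine Submodule.span_le.2 ?_ (adjoin_le_span_word x I hb)
    rintro _ ⟨w, ⟨hw, hw'⟩, rfl⟩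
    exact h w hw hw'

theorem mem_wotAlg_univ (a : A.toStarSubalgebra) : a ∈ wotAlg (x '' Set.univ) := by
  rw [Set.image_univ, hS.generates]
  trivial

/-- A vector orthogonal to all these word vectors defines a normal functional vanishing on nonempty
words, hence on `A`, including `1`. So the empty word is not needed. -/
theorem span_dense : (Submodule.span ℂ ((fun w => π (word x w) Ω) '' {w | w ≠ []})).topologicalClosure
    = ⊤ := by
  rw [Submodule.topologicalClosure_eq_top_iff, Submodule.eq_bot_iff]
  intro η hη
  refine hS.gns.ext_dense fun a => ?_
  have hR := (hS.gns.isNormalFunctional_vecFunctional hS.normal η Ω).boundedlyClosed_ker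
  refine LinearMap.mem_ker.1 (hS.mem_of_boundedlyClosed hR (fun w hw _ => ?_)
    (hS.mem_wotAlg_univ a))
  rw [LinearMap.mem_ker]
  exact inner_eq_zero_symm.1 (hη _ (Submodule.subset_span ⟨w, hw, rfl⟩))

theorem ext_words {η : K} (h : ∀ w, w ≠ [] → ⟪π (word x w) Ω, η⟫_ℂ = 0) : η = 0 := by
  have h1 : η ∈ (Submodule.span ℂ ((fun w => π (word x w) Ω) '' {w | w ≠ []}))ᗮ := by
    rw [Submodule.mem_orthogonal]
    intro ζ hζ
    induction hζ using Submodule.span_induction with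
    | mem ζ hζ => obtain ⟨w, hw, rfl⟩ := hζ; exact h w hw
    | zero => simp
    | add ζ ζ' _ _ h1 h2 => rw [inner_add_left, h1, h2, add_zero]
    | smul c ζ _ h1 => rw [inner_smul_left, h1, mul_zero]
  rwa [(Submodule.topologicalClosure_eq_top_iff).1 hS.span_dense, Submodule.mem_bot] at h1

theorem ext_operator {S T : K →L[ℂ] K}
    (h : ∀ w, w ≠ [] → S (π (word x w) Ω) = T (π (word x w) Ω)) : S = T := by
  have hd : Dense (Submodule.span ℂ ((fun w => π (word x w) Ω) '' {w | w ≠ []}) : Set K) :=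
    Submodule.dense_iff_topologicalClosure_eq_top.2 hS.span_dense
  refine ContinuousLinearMap.ext_on hd ?_
  rintro _ ⟨w, hw, rfl⟩
  exact h w hw

/-- Transposing the letters `i` and `0` preserves moments, hence Gram matrices of word vectors, and
turns the action of `x i` into that of `x 0`. The resulting uniform bound makes normality applicable
to shifted words. -/
theorem norm_le (i : ℕ) : ‖x i‖ ≤ ‖x 0‖ := by
  rw [← NonUnitalStarAlgHom.norm_map π hS.injective (x i)]
  have hd : Dense (Submodule.span ℂ (Set.range fun w => π (word x w) Ω) : Set K) := by
    refine (Submodule.dense_iff_topologicalClosure_eq_top.2 hS.span_dense).mono ?_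
    exact Submodule.span_mono (Set.image_subset_range _ _)
  refine ContinuousLinearMap.opNorm_le_bound _ (norm_nonneg _) fun ζ => ?_
  refine hd.induction (P := fun ζ => ‖π (x i) ζ‖ ≤ ‖x 0‖ * ‖ζ‖) (fun ζ hζ => ?_)
    (isClosed_le (by fun_prop) (by fun_prop)) ζ
  obtain ⟨c, rfl⟩ := (Finsupp.mem_span_range_iff_exists_finsupp).1 hζ
  have hτ : Function.Injective (Equiv.swap i 0) := (Equiv.swap i 0).injective
  have h1 : ‖Finsupp.linearCombination ℂ (fun w => π (word x w) Ω) c‖ =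
      ‖Finsupp.linearCombination ℂ (fun w => π (word x (w.map (Equiv.swap i 0))) Ω) c‖ := by
    refine norm_linearCombination_eq (fun u v => ?_) c
    rw [hS.inner_word_word, hS.inner_word_word, ← List.map_reverse, ← List.map_append]
    exact hS.moment_congr (SamePattern.map hτ _)
  have h2 : ‖Finsupp.linearCombination ℂ (fun w => π (word x (i :: w)) Ω) c‖ =
      ‖Finsupp.linearCombination ℂ (fun w => π (word x ((i :: w).map (Equiv.swap i 0))) Ω) c‖ := by
    refine norm_linearCombination_eq (fun u v => ?_) c
    rw [hS.inner_word_word, hS.inner_word_word, ← List.map_reverse, ← List.map_append]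
    exact hS.moment_congr (SamePattern.map hτ _)
  have h3 : ∀ (j : ℕ) (f : List ℕ → List ℕ), π (x j) (Finsupp.linearCombination ℂ
      (fun w => π (word x (f w)) Ω) c) =
      Finsupp.linearCombination ℂ (fun w => π (word x (j :: f w)) Ω) c := by
    intro j f
    simp only [Finsupp.linearCombination_apply, Finsupp.sum, map_sum, map_smul, word_cons, map_mul,
      mul_apply_eq_comp]
  have h4 := h3 i id
  simp only [id] at h4
  change ‖π (x i) (Finsupp.linearCombination ℂ (fun w => π (word x w) Ω) c)‖ ≤
    ‖x 0‖ * ‖Finsupp.linearCombination ℂ (fun w => π (word x w) Ω) c‖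
  rw [h4, h1, h2]
  simp only [List.map_cons, Equiv.swap_apply_left]
  rw [← h3 0]
  exact ContinuousLinearMap.le_of_opNorm_le _ (NonUnitalStarAlgHom.norm_apply_le π _) _

theorem norm_word_le (w : List ℕ) : ‖word x w‖ ≤ ‖(1 : A.toStarSubalgebra)‖ * ‖x 0‖ ^ w.length := by
  induction w with
  | nil => simp [word_nil]
  | cons i w ih =>
    rw [word_cons, List.length_cons, pow_succ]
    calc _ ≤ ‖x i‖ * ‖word x w‖ := norm_mul_le _ _
      _ ≤ ‖x 0‖ * (‖(1 : A.toStarSubalgebra)‖ * ‖x 0‖ ^ w.length) := by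
        gcongr
        exact hS.norm_le i
      _ = _ := by ring

theorem exists_bound (w : List ℕ) : ∃ r : ℝ, ∀ N, ‖word x (shift w N)‖ ≤ r :=
  ⟨_, fun N => by simpa [length_shift] using hS.norm_word_le (shift w N)⟩

/-- The shifted block has letters `≥ N` while its surroundings have letters `< N`, so neither
junction is ever an equality. -/
theorem moment_shift_congr {u w v : List ℕ} {N M : ℕ} (hu : ∀ i ∈ u, i < N) (hv : ∀ i ∈ v, i < N)
    (hM : N ≤ M) : φ (word x (u.reverse ++ (shift w M ++ v))) =
      φ (word x (u.reverse ++ (shift w N ++ v))) := by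
  have key : ∀ L, N ≤ L → ∀ i ∈ shift w L, N ≤ i := fun L hL i hi => hL.trans (mem_shift_le hi)
  apply hS.moment_congr
  rcases eq_or_ne w [] with rfl | hw
  · exact SamePattern.refl _
  refine SamePattern.append (SamePattern.refl _) (SamePattern.append_of_disjoint
    (samePattern_shift_shift w M N) (SamePattern.refl v) ?_ ?_) ?_
  · intro a ha b hb hab
    exact absurd (hv b hb) (by have := key M hM a ha; omega)
  · intro a ha b hb hab
    exact absurd (hv b hb) (by have := key N le_rfl a ha; omega)
  · intro a ha b hb a' ha' b' hb'
    rw [List.head?_append_of_ne_nil _ (shift_ne_nil hw _)] at hb hb'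
    have h1 := hu a (by simpa using List.mem_of_getLast? ha)
    have h2 := hu a' (by simpa using List.mem_of_getLast? ha')
    have h3 := key M hM b (List.mem_of_head? hb)
    have h4 := key N le_rfl b' (List.mem_of_head? hb')
    constructor <;> intro h <;> omega

theorem tendsto_limWord (w : List ℕ) :
    Tendsto (fun N => toWOT A (word x (shift w N))) atTop (𝓝 (toWOT A (limWord x w))) := by
  obtain ⟨r, hr⟩ := hS.exists_bound w
  have hex : ∃ e, Tendsto (fun N => toWOT A (word x (shift w N))) atTop (𝓝 (toWOT A e)) := by
    obtain ⟨b, hb⟩ := exists_tendsto_toWOT (hyperfilter ℕ) (a := fun N => word x (shift w N))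
      (Eventually.of_forall hr)
    have h1 : ∀ η ζ : K, Tendsto (fun N => ⟪η, π (word x (shift w N)) ζ⟫_ℂ) atTop
        (𝓝 ⟪η, π b ζ⟫_ℂ) := by
      refine tendsto_inner_of_dense (r := r) (Eventually.of_forall fun N =>
        (NonUnitalStarAlgHom.norm_apply_le π _).trans (hr N)) hS.span_dense ?_
      rintro _ ⟨u, hu, rfl⟩ _ ⟨v, hv, rfl⟩
      obtain ⟨N, hN⟩ := exists_lt (u ++ v)
      -- Between two word vectors the coefficients are eventually constant; an ultrafilter limit `b`
      -- merely supplies an operator to which they converge.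
      have hc : ∀ᶠ M in atTop, φ (word x (u.reverse ++ (shift w N ++ v))) =
          ⟪π (word x u) Ω, π (word x (shift w M)) (π (word x v) Ω)⟫_ℂ := by
        filter_upwards [eventually_ge_atTop N] with M hM
        rw [hS.inner_word, hS.moment_shift_congr (fun i hi => hN i (by simp [hi]))
          (fun i hi => hN i (by simp [hi])) hM]
      have h2 := tendsto_const_nhds.congr' hc
      have h3 := hS.gns.tendsto_inner hS.normal (Eventually.of_forall hr) hb (π (word x u) Ω)
        (π (word x v) Ω)
      have h4 : ((hyperfilter ℕ : Ultrafilter ℕ) : Filter ℕ) ≤ atTop := by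
        rw [← Nat.cofinite_eq_atTop]
        exact hyperfilter_le_cofinite
      rwa [tendsto_nhds_unique h3 (h2.mono_left h4)]
    obtain ⟨e, -, he⟩ := hS.gns.exists_tendsto hS.normal hS.injective (Eventually.of_forall hr) h1
    exact ⟨e, he⟩
  rw [limWord, dif_pos hex]
  exact hex.choose_spec

theorem tendsto_inner_limWord (w : List ℕ) (η ζ : K) :
    Tendsto (fun N => ⟪η, π (word x (shift w N)) ζ⟫_ℂ) atTop (𝓝 ⟪η, π (limWord x w) ζ⟫_ℂ) := by
  obtain ⟨r, hr⟩ := hS.exists_bound w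
  exact hS.gns.tendsto_inner hS.normal (Eventually.of_forall hr) (hS.tendsto_limWord w) η ζ

theorem tendsto_inner_limWord_left (w : List ℕ) (η ζ : K) :
    Tendsto (fun N => ⟪π (word x (shift w N)) η, ζ⟫_ℂ) atTop (𝓝 ⟪π (limWord x w) η, ζ⟫_ℂ) := by
  have := (Complex.continuous_conj.tendsto _).comp (hS.tendsto_inner_limWord w ζ η)
  simpa only [Function.comp_def, inner_conj_symm] using this

theorem inner_limWord {u w v : List ℕ} {N : ℕ} (hu : ∀ i ∈ u, i < N) (hv : ∀ i ∈ v, i < N) :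
    ⟪π (word x u) Ω, π (limWord x w) (π (word x v) Ω)⟫_ℂ =
      φ (word x (u.reverse ++ (shift w N ++ v))) := by
  refine tendsto_nhds_unique (hS.tendsto_inner_limWord w _ _) (tendsto_const_nhds.congr' ?_)
  filter_upwards [eventually_ge_atTop N] with M hM
  rw [hS.inner_word, hS.moment_shift_congr hu hv hM]

theorem inner_word_limVec {u w : List ℕ} {N : ℕ} (hu : ∀ i ∈ u, i < N) :
    ⟪π (word x u) Ω, π (limWord x w) Ω⟫_ℂ = φ (word x (u.reverse ++ shift w N)) := by
  simpa [word_nil] using hS.inner_limWord (w := w) (v := []) hu (by simp)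

/-- With `u` shifted by `M` and `w` beyond it by `N + M`, the whole word is a common shift by `M`,
so the iterated limit is already attained. -/
theorem inner_limVec_limVec {u w : List ℕ} {N : ℕ} (hu : ∀ i ∈ u, i < N) :
    ⟪π (limWord x u) Ω, π (limWord x w) Ω⟫_ℂ = φ (word x (u.reverse ++ shift w N)) := by
  refine tendsto_nhds_unique (hS.tendsto_inner_limWord_left u _ _) (tendsto_const_nhds.congr ?_)
  intro M
  rw [hS.inner_word_limVec (N := N + M) fun i hi => mem_shift_lt hu hi]
  have h : (shift u M).reverse ++ shift w (N + M) = shift (u.reverse ++ shift w N) M := by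
    simp [shift, Function.comp_def, add_assoc]
  rw [h]
  exact hS.moment_congr (samePattern_shift _ M)

end IsBooleanSystem

end Setting

end BoolDeFinetti

namespace BoolDeFinetti

attribute [local instance] isClosed_toStarSubalgebra

open Filter

/-! ### The projection onto the tail -/

section Tail

variable {H : Type*} [NormedAddCommGroup H] [InnerProductSpace ℂ H] [CompleteSpace H]
  {A : VonNeumannAlgebra H} {K : Type*} [NormedAddCommGroup K] [InnerProductSpace ℂ K]
  [CompleteSpace K] {φ : A.toStarSubalgebra →ₗ[ℂ] ℂ} {x : ℕ → A.toStarSubalgebra}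
  {π : A.toStarSubalgebra →⋆ₐ[ℂ] (K →L[ℂ] K)} {Ω : K}

variable (x π Ω) in
/-- The closed subspace spanned by the limits of shifted words, applied to the cyclic vector. -/
noncomputable def tailSpace : Submodule ℂ K :=
  (Submodule.span ℂ ((fun w => π (limWord x w) Ω) '' {w | w ≠ []})).topologicalClosure

instance : CompleteSpace (tailSpace x π Ω) :=
  inferInstanceAs (CompleteSpace (Submodule.topologicalClosure _))

variable (x π Ω) in
/-- The projection onto `tailSpace`. -/
noncomputable def tailProj : K →L[ℂ] K := (tailSpace x π Ω).starProjection

theorem inner_tailProj (η ζ : K) : ⟪tailProj x π Ω η, ζ⟫_ℂ = ⟪η, tailProj x π Ω ζ⟫_ℂ :=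
  Submodule.inner_starProjection_left_eq_right _ _ _

theorem tailProj_tailProj (η : K) : tailProj x π Ω (tailProj x π Ω η) = tailProj x π Ω η :=
  Submodule.starProjection_eq_self_iff.2 (Submodule.starProjection_apply_mem _ _)

namespace IsBooleanSystem

variable (hS : IsBooleanSystem φ x π Ω)
include hS

/-- A word vector and its limit vector have the same inner product with every limit vector, so their
difference is orthogonal to the tail space. -/
theorem tailProj_word {w : List ℕ} (hw : w ≠ []) :
    tailProj x π Ω (π (word x w) Ω) = π (limWord x w) Ω := by
  have h0 : π (limWord x w) Ω ∈ tailSpace x π Ω :=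
    Submodule.le_topologicalClosure _ (Submodule.subset_span ⟨w, hw, rfl⟩)
  refine Submodule.eq_starProjection_of_mem_of_inner_eq_zero h0 ?_
  have h1 : π (word x w) Ω - π (limWord x w) Ω ∈
      (Submodule.span ℂ ((fun w => π (limWord x w) Ω) '' {w | w ≠ []}))ᗮ := by
    rw [Submodule.mem_orthogonal']
    intro ζ hζ
    induction hζ using Submodule.span_induction with
    | mem ζ hζ =>
      obtain ⟨u, hu, rfl⟩ := hζ
      obtain ⟨N, hN⟩ := exists_lt w
      rw [inner_sub_left, hS.inner_word_limVec hN, hS.inner_limVec_limVec hN, sub_self]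
    | zero => simp
    | add ζ ζ' _ _ h1 h2 => rw [inner_add_right, h1, h2, add_zero]
    | smul c ζ _ h1 => rw [inner_smul_right, h1, mul_zero]
  rw [← Submodule.orthogonal_closure, Submodule.mem_orthogonal'] at h1
  exact h1

/-- Between word vectors, `Q` shifts all letters from `j` on far away. This changes only the
junction with `i`, which is an inequality both before, as `i ≠ j`, and after. -/
theorem mul_tailProj_mul {i j : ℕ} (hij : i ≠ j) :
    π (x i) * tailProj x π Ω * π (x j) = π (x i) * π (x j) := by
  refine hS.ext_operator fun w hw => ?_
  refine sub_eq_zero.1 (hS.ext_words fun u hu => ?_)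
  have h1 : π (x j) (π (word x w) Ω) = π (word x (j :: w)) Ω := by
    rw [word_cons, map_mul, mul_apply_eq_comp]
  have h2 : ∀ ζ, ⟪π (word x u) Ω, π (x i) ζ⟫_ℂ = ⟪π (word x (i :: u)) Ω, ζ⟫_ℂ := by
    intro ζ
    rw [word_cons, map_mul, mul_apply_eq_comp, inner_rep_left π (x i), (hS.selfAdjoint i).star_eq]
  obtain ⟨N, hN⟩ := exists_lt (i :: u)
  rw [mul_apply_eq_comp, mul_apply_eq_comp, mul_apply_eq_comp, h1,
    hS.tailProj_word (List.cons_ne_nil _ _), inner_sub_right, h2, h2, hS.inner_word_limVec hN,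
    hS.inner_word_word, sub_eq_zero]
  refine hS.moment_congr (SamePattern.append (SamePattern.refl _) (samePattern_shift_left _ _) ?_)
  intro a ha b hb a' ha' b' hb'
  simp only [List.getLast?_reverse, List.head?_cons, Option.mem_def, Option.some.injEq] at ha ha' hb'
  subst ha ha' hb'
  have h3 := mem_shift_le (List.mem_of_head? hb)
  have h4 := hN i (by simp)
  constructor
  · intro h; omega
  · intro h; exact absurd h hij

/-- The outer words are sent to infinity while `w` stays, and this has the same pattern as keeping
them and shifting `w`: either way the middle block shares no letter with its neighbours. -/
theorem inner_tailProj_word {u w v : List ℕ} {N : ℕ} (hu : u ≠ []) (hw : w ≠ []) (hv : v ≠ [])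
    (huN : ∀ i ∈ u, i < N) (hvN : ∀ i ∈ v, i < N) :
    ⟪π (word x u) Ω, tailProj x π Ω (π (word x w) (tailProj x π Ω (π (word x v) Ω)))⟫_ℂ =
      φ (word x (u.reverse ++ (shift w N ++ v))) := by
  rw [← inner_tailProj, hS.tailProj_word hu, hS.tailProj_word hv]
  refine tendsto_nhds_unique (hS.tendsto_inner_limWord_left u _ _) (tendsto_const_nhds.congr' ?_)
  obtain ⟨M₀, hM₀⟩ := exists_lt w
  filter_upwards [eventually_ge_atTop M₀] with M hM
  have h1 : ⟪π (word x (shift u M)) Ω, π (word x w) (π (limWord x v) Ω)⟫_ℂ =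
      ⟪π (word x (w.reverse ++ shift u M)) Ω, π (limWord x v) Ω⟫_ℂ := by
    rw [word_append, map_mul, mul_apply_eq_comp, inner_rep_left π (word x w.reverse),
      star_word x hS.selfAdjoint, List.reverse_reverse]
  have h2 : ∀ i ∈ w.reverse ++ shift u M, i < N + M := by
    intro i hi
    rcases List.mem_append.1 hi with h | h
    · have := hM₀ i (by simpa using h)
      omega
    · exact mem_shift_lt huN h
  rw [h1, hS.inner_word_limVec h2, List.reverse_append, List.reverse_reverse, List.append_assoc,
    shift_reverse]
  refine hS.moment_congr (SamePattern.append (samePattern_shift _ _) (SamePattern.append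
    (samePattern_shift_left _ _) (samePattern_shift _ _) ?_) ?_)
  · intro a ha b hb a' ha' b' hb'
    have h3 := mem_shift_le (List.mem_of_getLast? ha)
    have h4 := hvN b (List.mem_of_head? hb)
    have h5 := hM₀ a' (List.mem_of_getLast? ha')
    have h6 := mem_shift_le (List.mem_of_head? hb')
    constructor <;> intro h <;> omega
  · intro a ha b hb a' ha' b' hb'
    have h3 := huN a (by simpa using List.mem_of_getLast? ha)
    have h4 := mem_shift_le (List.mem_of_getLast? ha')
    rw [List.head?_append_of_ne_nil _ (shift_ne_nil hw _)] at hb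
    rw [List.head?_append_of_ne_nil _ hw] at hb'
    have h5 := mem_shift_le (List.mem_of_head? hb)
    have h6 := hM₀ b' (List.mem_of_head? hb')
    constructor <;> intro h <;> omega

theorem rep_limWord {w : List ℕ} (hw : w ≠ []) :
    π (limWord x w) = tailProj x π Ω * π (word x w) * tailProj x π Ω := by
  refine hS.ext_operator fun v hv => ?_
  refine sub_eq_zero.1 (hS.ext_words fun u hu => ?_)
  obtain ⟨N, hN⟩ := exists_lt (u ++ v)
  have huN : ∀ i ∈ u, i < N := fun i hi => hN i (by simp [hi])
  have hvN : ∀ i ∈ v, i < N := fun i hi => hN i (by simp [hi])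
  rw [mul_apply_eq_comp, mul_apply_eq_comp, inner_sub_right, hS.inner_limWord huN hvN,
    hS.inner_tailProj_word hu hw hv huN hvN, sub_self]

/-- The tail projection belongs to the represented von Neumann algebra. -/
theorem exists_rep_eq_tailProj : ∃ e, π e = tailProj x π Ω := by
  let Q := tailProj x π Ω
  -- The elements whose compression by `Q` is represented. Words belong to it by `rep_limWord`; the
  -- aim is that `1` does too, as `Q 1 Q = Q`.
  let R : Submodule ℂ A.toStarSubalgebra :=
    (LinearMap.range (π : A.toStarSubalgebra →ₗ[ℂ] (K →L[ℂ] K))).comap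
      (LinearMap.mulLeft ℂ Q ∘ₗ LinearMap.mulRight ℂ Q ∘ₗ
        (π : A.toStarSubalgebra →ₗ[ℂ] (K →L[ℂ] K)))
  have hRmem : ∀ a, a ∈ R ↔ ∃ c, π c = Q * (π a * Q) := fun a => Iff.rfl
  have hQ : ‖Q‖ ≤ 1 := Submodule.starProjection_norm_le _
  have hR : BoundedlyClosed R := by
    intro F _ r b hF hFR hb
    rw [hRmem]
    -- The filter lives on all of `A` and is only eventually in `R`, so the preimages are chosen
    -- totally, with the default `0` outside `R`.
    have hex : ∀ a : A.toStarSubalgebra, ∃ c, a ∈ R → π c = Q * (π a * Q) := by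
      intro a
      by_cases ha : a ∈ R
      · obtain ⟨c, hc⟩ := (hRmem a).1 ha
        exact ⟨c, fun _ => hc⟩
      · exact ⟨0, fun h => absurd h ha⟩
    choose c hc using hex
    have hcr : ∀ᶠ a in F, ‖c a‖ ≤ r := by
      filter_upwards [hF, hFR] with a ha haR
      rw [← NonUnitalStarAlgHom.norm_map π hS.injective (c a), hc a haR]
      calc ‖Q * (π a * Q)‖ ≤ ‖Q‖ * (‖π a‖ * ‖Q‖) :=
            (norm_mul_le _ _).trans (by gcongr; exact norm_mul_le _ _)
        _ ≤ 1 * (r * 1) := by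
            have := (norm_nonneg _).trans ha
            have := (NonUnitalStarAlgHom.norm_apply_le π a).trans ha
            gcongr
        _ = r := by ring
    have hct : ∀ η ζ, Tendsto (fun a => ⟪η, π (c a) ζ⟫_ℂ) F (𝓝 ⟪η, (Q * (π b * Q)) ζ⟫_ℂ) := by
      intro η ζ
      have h1 := hS.gns.tendsto_inner hS.normal (a := id) hF hb (Q η) (Q ζ)
      have h2 : ⟪Q η, π b (Q ζ)⟫_ℂ = ⟪η, (Q * (π b * Q)) ζ⟫_ℂ := inner_tailProj _ _
      rw [← h2]
      refine h1.congr' ?_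
      filter_upwards [hFR] with a haR
      rw [hc a haR]
      exact inner_tailProj _ _
    obtain ⟨d, hd, -⟩ := hS.gns.exists_tendsto hS.normal hS.injective hcr hct
    exact ⟨d, hd⟩
  have h1 : (1 : A.toStarSubalgebra) ∈ R := by
    refine hS.mem_of_boundedlyClosed hR (fun w hw _ => ?_) (hS.mem_wotAlg_univ 1)
    rw [hRmem, ← mul_assoc]
    exact ⟨_, hS.rep_limWord hw⟩
  obtain ⟨e, he⟩ := (hRmem 1).1 h1
  refine ⟨e, he.trans ?_⟩
  rw [map_one, one_mul]
  ext1 ζ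
  exact tailProj_tailProj ζ

/-- Shifting a word does not change its moment, so word vectors and their limits have the same inner
product with `Ω`. This gives preservation of `φ`. -/
theorem tailProj_cyclic : tailProj x π Ω Ω = Ω := by
  refine sub_eq_zero.1 (hS.ext_words fun w hw => ?_)
  rw [inner_sub_right, ← inner_tailProj, hS.tailProj_word hw, sub_eq_zero]
  have h := tendsto_nhds_unique (hS.tendsto_inner_limWord_left w Ω Ω)
    (tendsto_const_nhds.congr (f₁ := fun _ => ⟪π (word x w) Ω, Ω⟫_ℂ) fun N => ?_)
  · exact h
  · have h1 : ∀ u, ⟪π (word x u) Ω, Ω⟫_ℂ = φ (word x u.reverse) := by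
      intro u
      simpa [word_nil] using hS.inner_word_word u []
    rw [h1, h1, shift_reverse]
    exact hS.moment_congr (samePattern_shift _ _)

/-- On the tail algebra, the tail projection acts as the identity. -/
theorem tailProj_mul_rep_mul_tailProj {t : A.toStarSubalgebra} (ht : t ∈ tailAlg x) :
    tailProj x π Ω * π t * tailProj x π Ω = π t := by
  refine hS.ext_operator fun v hv => ?_
  refine sub_eq_zero.1 (hS.ext_words fun u hu => ?_)
  obtain ⟨N, hN⟩ := exists_lt (u ++ v)
  have huN : ∀ i ∈ u, i < N := fun i hi => hN i (by simp [hi])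
  have hvN : ∀ i ∈ v, i < N := fun i hi => hN i (by simp [hi])
  -- The cut-off `N` exceeds the letters of both test words, so `t` may be replaced by words whose
  -- letters are disjoint from theirs; such words have the pattern of their own shifts.
  have ht' : t ∈ wotAlg (x '' {k | N ≤ k}) := (NonUnitalAlgebra.mem_iInf.1 ht) N
  have hψ := ((hS.gns.isNormalFunctional_vecFunctional hS.normal
    (tailProj x π Ω (π (word x u) Ω)) (tailProj x π Ω (π (word x v) Ω))).sub
    (hS.gns.isNormalFunctional_vecFunctional hS.normal (π (word x u) Ω)
      (π (word x v) Ω))).boundedlyClosed_ker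
  rw [mul_apply_eq_comp, mul_apply_eq_comp, inner_sub_right, ← inner_tailProj]
  refine LinearMap.mem_ker.1 (hS.mem_of_boundedlyClosed hψ (fun w hw hwN => ?_) ht')
  rw [LinearMap.mem_ker]
  change ⟪tailProj x π Ω (π (word x u) Ω), π (word x w) (tailProj x π Ω (π (word x v) Ω))⟫_ℂ -
    ⟪π (word x u) Ω, π (word x w) (π (word x v) Ω)⟫_ℂ = 0
  rw [inner_tailProj, hS.inner_tailProj_word hu hw hv huN hvN, hS.inner_word, sub_eq_zero]
  refine hS.moment_congr (SamePattern.append (SamePattern.refl _) (SamePattern.append_of_disjoint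
    (samePattern_shift_left _ _) (SamePattern.refl _) ?_ ?_) ?_)
  · intro a ha b hb
    have := mem_shift_le ha
    have := hvN b hb
    omega
  · intro a ha b hb
    have : N ≤ a := hwN a ha
    have := hvN b hb
    omega
  · intro a ha b hb a' ha' b' hb'
    rw [List.head?_append_of_ne_nil _ (shift_ne_nil hw _)] at hb
    rw [List.head?_append_of_ne_nil _ hw] at hb'
    have h1 := huN a (by simpa using List.mem_of_getLast? ha)
    have h2 := huN a' (by simpa using List.mem_of_getLast? ha')
    have h3 := mem_shift_le (List.mem_of_head? hb)
    have h4 : N ≤ b' := hwN b' (List.mem_of_head? hb')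
    constructor <;> intro h <;> omega

end IsBooleanSystem

/-- The projection `e` onto the tail of the sequence `x`: the tail algebra is `e A e`. -/
structure IsTailProjection (φ : A.toStarSubalgebra →ₗ[ℂ] ℂ) (x : ℕ → A.toStarSubalgebra)
    (e : A.toStarSubalgebra) : Prop where
  idem : e * e = e
  mul_mul : ∀ i j, i ≠ j → x i * e * x j = x i * x j
  apply_mul_mul : ∀ a, φ (e * a * e) = φ a
  tendsto : ∀ w, w ≠ [] →
    Tendsto (fun N => toWOT A (word x (shift w N))) atTop (𝓝 (toWOT A (e * word x w * e)))
  mul_mul_mem : ∀ a, e * a * e ∈ tailAlg x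
  of_mem : ∀ t ∈ tailAlg x, e * t * e = t

theorem IsBooleanSystem.exists_isTailProjection (hS : IsBooleanSystem φ x π Ω) :
    ∃ e, IsTailProjection φ x e := by
  obtain ⟨e, he⟩ := hS.exists_rep_eq_tailProj
  have hlim : ∀ w, w ≠ [] →
      Tendsto (fun N => toWOT A (word x (shift w N))) atTop (𝓝 (toWOT A (e * word x w * e))) := by
    intro w hw
    have h : limWord x w = e * word x w * e := by
      apply hS.injective
      rw [hS.rep_limWord hw, map_mul, map_mul, he]
    rw [← h]
    exact hS.tendsto_limWord w
  refine ⟨e, ⟨hS.injective ?_, fun i j hij => hS.injective ?_, fun a => ?_, hlim, fun a => ?_,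
    fun t ht => hS.injective ?_⟩⟩
  · rw [map_mul, he]
    ext1 ζ
    exact tailProj_tailProj ζ
  · rw [map_mul, map_mul, map_mul, he, hS.mul_tailProj_mul hij]
  · rw [hS.gns.apply_eq, hS.gns.apply_eq, map_mul, map_mul, he, mul_apply_eq_comp,
      mul_apply_eq_comp, ← inner_tailProj, hS.tailProj_cyclic]
  · refine NonUnitalAlgebra.mem_iInf.2 fun M => ?_
    -- For a word, the compression is the limit of shifts, which eventually use only letters `≥ M`.
    let R : Submodule ℂ A.toStarSubalgebra := (wotAlg (x '' {k | M ≤ k})).toSubmodule.comap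
      (LinearMap.mulRight ℂ e ∘ₗ LinearMap.mulLeft ℂ e)
    have hR : BoundedlyClosed R := fun F _ r b _ hFR hb =>
      mem_wotAlg_of_tendsto (S := x '' {k | M ≤ k}) hFR (tendsto_toWOT_mul_mul (a := id) hb e e)
    refine hS.mem_of_boundedlyClosed hR (fun w hw _ => ?_) (hS.mem_wotAlg_univ a)
    refine mem_wotAlg_of_tendsto ?_ (hlim w hw)
    filter_upwards [eventually_ge_atTop M] with N hN
    exact subset_wotAlg _ (word_mem_adjoin x (shift_ne_nil hw N) fun i hi =>
      hN.trans (mem_shift_le hi))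
  · rw [map_mul, map_mul, he, hS.tailProj_mul_rep_mul_tailProj ht]

end Tail

end BoolDeFinetti

namespace BoolDeFinetti

attribute [local instance] isClosed_toStarSubalgebra

open Filter

/-! ### The conditional expectation onto the tail algebra -/

section Corner

variable {R : Type*} [Monoid R] {e : R}

theorem mul_prod_mul_of_getLast (he : e * e = e) {l : List R} {y : R}
    (h : ∀ a ∈ l.getLast?, a * e * y = a * y) : e * l.prod * e * y = e * l.prod * y := by
  rcases l.eq_nil_or_concat with rfl | ⟨l, a, rfl⟩
  · rw [List.prod_nil, mul_one, he]
  · have h1 := h a (by simp)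
    simp only [List.concat_eq_append, List.prod_append, List.prod_singleton, mul_assoc] at h1 ⊢
    rw [h1]

theorem mul_prod_mul_of_head (he : e * e = e) {l : List R} {y : R}
    (h : ∀ b ∈ l.head?, y * e * b = y * b) : y * e * l.prod * e = y * l.prod * e := by
  cases l with
  | nil => rw [List.prod_nil, mul_one, mul_one, mul_assoc, he]
  | cons b l =>
    have h1 := h b rfl
    rw [List.prod_cons, ← mul_assoc, ← mul_assoc, h1]

/-- Each inner `e` is removed by the relation with the adjacent factor or, at an end of the product,
absorbed by the outer `e`. -/
theorem mul_prod_set_mul (he : e * e = e) {l : List R} {m : ℕ} (hm : m < l.length)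
    (h1 : ∀ a ∈ (l.take m).getLast?, a * e * l[m] = a * l[m])
    (h2 : ∀ b ∈ (l.drop (m + 1)).head?, l[m] * e * b = l[m] * b) :
    e * (l.set m (e * l[m] * e)).prod * e = e * l.prod * e := by
  have h3 : l.prod = (l.take m).prod * (l[m] * (l.drop (m + 1)).prod) := by
    conv_lhs => rw [← List.take_append_drop m l, List.drop_eq_getElem_cons hm]
    rw [List.prod_append, List.prod_cons]
  rw [List.prod_set, if_pos hm, h3]
  calc _ = e * (l.take m).prod * e * l[m] * e * (l.drop (m + 1)).prod * e := by
        simp only [mul_assoc]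
    _ = e * (l.take m).prod * (l[m] * e * (l.drop (m + 1)).prod * e) := by
        rw [mul_prod_mul_of_getLast he h1]
        simp only [mul_assoc]
    _ = _ := by
        rw [mul_prod_mul_of_head he h2]
        simp only [mul_assoc]

/-- If `a e b = a b`, then `e` can be inserted between `L a β` and `γ b M`, if `β` and `γ` are
absorbed by `e` or scalars. -/
theorem mul_insert_mul {B : Type*} [Ring B] [Algebra ℂ B] {e a b : B} (h : a * e * b = a * b)
    {β γ : B} (hβ : (e * β = β ∧ β * e = β) ∨ ∃ c : ℂ, β = algebraMap ℂ B c)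
    (hγ : (e * γ = γ ∧ γ * e = γ) ∨ ∃ c : ℂ, γ = algebraMap ℂ B c) (L M : B) :
    L * (a * β) * e * (γ * (b * M)) = L * (a * β) * (γ * (b * M)) := by
  rcases hβ with h1 | ⟨c, rfl⟩
  · rw [mul_assoc L, mul_assoc a, h1.2]
  · rcases hγ with h2 | ⟨c', rfl⟩
    · rw [mul_assoc _ e, ← mul_assoc e, h2.1]
    · simp only [Algebra.algebraMap_eq_smul_one, mul_smul_comm, smul_mul_assoc, mul_one, one_mul]
      rw [mul_assoc L a e, mul_assoc L (a * e), ← mul_assoc (a * e), h]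
      simp only [mul_assoc]

theorem map_monomial_concat {R B : Type*} [Ring R] [Algebra ℂ R] [Ring B] [Algebra ℂ B]
    (f : R →ₐ[ℂ] B) (X b₀ b : R) (l : List R) :
    f (b₀ * ((l.concat b).map fun b => X * b).prod) =
      f (b₀ * (l.map fun b => X * b).prod) * (f X * f b) := by
  rw [List.concat_eq_append, List.map_append, List.prod_append, List.map_cons, List.map_nil,
    List.prod_singleton, ← mul_assoc, map_mul f _ (X * b), map_mul f X b]

theorem map_monomial_cons {R B : Type*} [Ring R] [Algebra ℂ R] [Ring B] [Algebra ℂ B]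
    (f : R →ₐ[ℂ] B) (X b₀ b : R) (l : List R) :
    f (b₀ * ((b :: l).map fun b => X * b).prod) =
      f b₀ * (f X * f (b * (l.map fun b => X * b).prod)) := by
  rw [List.map_cons, List.prod_cons, mul_assoc X, map_mul f b₀, map_mul f X]

end Corner

/-! ### Compression by the tail projection as the conditional expectation. -/

section CondExp

variable {H : Type*} [NormedAddCommGroup H] [InnerProductSpace ℂ H] [CompleteSpace H]
  {A : VonNeumannAlgebra H} {φ : A.toStarSubalgebra →ₗ[ℂ] ℂ} {x : ℕ → A.toStarSubalgebra}
  {e : A.toStarSubalgebra}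

/-- The compression `a ↦ e a e`. -/
noncomputable def corner (e : A.toStarSubalgebra) : A.toStarSubalgebra →ₗ[ℂ] A.toStarSubalgebra :=
  LinearMap.mulRight ℂ e ∘ₗ LinearMap.mulLeft ℂ e

theorem corner_apply (e a : A.toStarSubalgebra) : corner e a = e * a * e := rfl

theorem isNormalMap_corner (e : A.toStarSubalgebra) : IsNormalMap (corner e) := by
  intro r b _
  refine Tendsto.mono_left ?_ inf_le_left
  have h : ∀ c, @nhds _ (wot A) c = comap (toWOT A) (𝓝 (toWOT A c)) := fun c => nhds_induced _ _
  rw [h, h, tendsto_comap_iff]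
  exact tendsto_toWOT_mul_mul (a := id) tendsto_comap e e

namespace IsTailProjection

variable (he : IsTailProjection φ x e)
include he

theorem mul_of_mem {t : A.toStarSubalgebra} (ht : t ∈ tailAlg x) : e * t = t := by
  rw [← he.of_mem t ht, ← mul_assoc, ← mul_assoc, he.idem]

theorem of_mem_mul {t : A.toStarSubalgebra} (ht : t ∈ tailAlg x) : t * e = t := by
  rw [← he.of_mem t ht, mul_assoc, he.idem]

theorem isNormalCondExp : IsNormalCondExp φ (tailAlg x) (corner e) where
  mem := he.mul_mul_mem
  id_on := he.of_mem
  left_module t ht a := by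
    rw [corner_apply, corner_apply, ← mul_assoc, he.mul_of_mem ht, ← mul_assoc, ← mul_assoc,
      he.of_mem_mul ht]
  right_module t ht a := by
    rw [corner_apply, corner_apply]
    simp only [mul_assoc]
    rw [he.of_mem_mul ht, he.mul_of_mem ht]
  preserving := he.apply_mul_mul
  normal := isNormalMap_corner e

/-- The difference `d` of the two expectations lies in `e A e`, so in `φ(b d c)` the elements `b`,
`c` may be compressed into the tail algebra. There the module property and preservation of `φ`
reduce either expectation of `a` to `a` itself, and non-degeneracy gives `d = 0`. -/
theorem eq_corner (hnd : NonDegenerated φ) {E : A.toStarSubalgebra →ₗ[ℂ] A.toStarSubalgebra}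
    (hE : IsNormalCondExp φ (tailAlg x) E) : E = corner e := by
  have hC := he.isNormalCondExp
  ext1 a
  refine sub_eq_zero.1 (hnd _ fun b c => ?_)
  set d := E a - corner e a with hd
  have hdT : d ∈ tailAlg x := sub_mem (hE.mem a) (hC.mem a)
  have h1 : φ (b * d * c) = φ (corner e b * d * corner e c) := by
    rw [← he.apply_mul_mul, ← he.of_mem d hdT, corner_apply, corner_apply]
    simp only [mul_assoc]
    rw [← mul_assoc e e, he.idem]
    simp only [← mul_assoc]
    rw [mul_assoc _ e e, he.idem]
  have h2 : ∀ E' : A.toStarSubalgebra →ₗ[ℂ] A.toStarSubalgebra,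
      IsNormalCondExp φ (tailAlg x) E' →
      φ (corner e b * E' a * corner e c) = φ (corner e b * a * corner e c) := by
    intro E' hE'
    rw [← hE'.left_module _ (hC.mem b), ← hE'.right_module _ (hC.mem c), hE'.preserving]
  rw [h1, hd, mul_sub, sub_mul, map_sub, h2 E hE, h2 _ hC, sub_self]

/-- Coefficients of polynomials are absorbed by `e`, or they are scalars. -/
theorem eval_coeff (y : A.toStarSubalgebra) {b : NCPoly (tailAlg x)}
    (hb : b ∈ Set.range (NCPoly.C (B := tailAlg x)) ∪
      Set.range (algebraMap ℂ (NCPoly (tailAlg x)))) :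
    (e * NCPoly.eval y b = NCPoly.eval y b ∧ NCPoly.eval y b * e = NCPoly.eval y b) ∨
      ∃ c : ℂ, NCPoly.eval y b = algebraMap ℂ _ c := by
  rcases hb with ⟨t, rfl⟩ | ⟨c, rfl⟩
  · rw [NCPoly.eval_C]
    exact Or.inl ⟨he.mul_of_mem t.2, he.of_mem_mul t.2⟩
  · exact Or.inr ⟨c, by rw [AlgHom.commutes]⟩

/-- The value of a monomial at `y` begins with `γ y` and ends with `y β`, where `β` and `γ` are
absorbed by `e` or scalars. -/
theorem eval_monomial (y : A.toStarSubalgebra) {p : NCPoly (tailAlg x)}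
    (hp : ∃ (b₀ : NCPoly (tailAlg x)) (l : List (NCPoly (tailAlg x))), l ≠ [] ∧
      (∀ b ∈ b₀ :: l, b ∈ Set.range (NCPoly.C (B := tailAlg x)) ∪
        Set.range (algebraMap ℂ (NCPoly (tailAlg x)))) ∧
      p = b₀ * (l.map fun b => NCPoly.X * b).prod) :
    ∃ L β γ M, ((e * β = β ∧ β * e = β) ∨ ∃ c : ℂ, β = algebraMap ℂ _ c) ∧
      ((e * γ = γ ∧ γ * e = γ) ∨ ∃ c : ℂ, γ = algebraMap ℂ _ c) ∧
      NCPoly.eval y p = L * (y * β) ∧ NCPoly.eval y p = γ * (y * M) := by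
  obtain ⟨b₀, l, hl, hb, hp⟩ := hp
  obtain ⟨l', b, hl'⟩ := l.eq_nil_or_concat.resolve_left hl
  obtain ⟨d, k, hk⟩ := List.exists_cons_of_ne_nil hl
  have h1 := map_monomial_concat (NCPoly.eval y) NCPoly.X b₀ b l'
  have h2 := map_monomial_cons (NCPoly.eval y) NCPoly.X b₀ d k
  rw [NCPoly.eval_X] at h1 h2
  have hbl : b ∈ b₀ :: l := by rw [hl']; simp
  refine ⟨_, NCPoly.eval y b, NCPoly.eval y b₀, _, he.eval_coeff y (hb b hbl),
    he.eval_coeff y (hb b₀ List.mem_cons_self), Eq.trans ?_ h1, Eq.trans ?_ h2⟩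
  · rw [hp, hl']
  · rw [hp, hk]

/-- Absence of constant terms guarantees an actual `x i` and `x j` at the junction, separated only
by coefficients; these either absorb `e` or are scalars, leaving `x i * e * x j`. -/
theorem eval_mul_eval {i j : ℕ} (hij : i ≠ j) {p q : NCPoly (tailAlg x)}
    (hp : p ∈ NCPoly.noConst (tailAlg x)) (hq : q ∈ NCPoly.noConst (tailAlg x)) :
    NCPoly.eval (x i) p * e * NCPoly.eval (x j) q =
      NCPoly.eval (x i) p * NCPoly.eval (x j) q := by
  induction hp using Submodule.span_induction with
  | zero => simp
  | add p p' _ _ h1 h2 => simp only [map_add, add_mul, h1, h2]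
  | smul c p _ h1 => simp only [map_smul, smul_mul_assoc, h1]
  | mem p hp =>
    induction hq using Submodule.span_induction with
    | zero => simp
    | add q q' _ _ h1 h2 => simp only [map_add, mul_add, h1, h2]
    | smul c q _ h1 => simp only [map_smul, mul_smul_comm, h1]
    | mem q hq =>
      obtain ⟨L, β, -, -, hβ, -, h1, -⟩ := he.eval_monomial (x i) hp
      obtain ⟨-, -, γ, M, -, hγ, -, h2⟩ := he.eval_monomial (x j) hq
      rw [h1, h2]
      exact mul_insert_mul (he.mul_mul i j hij) hβ hγ L M

theorem corner_prod_eq {n : ℕ} {p : Fin n → NCPoly (tailAlg x)} {i : Fin n → ℕ} {m : Fin n}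
    (hp : ∀ j, p j ∈ NCPoly.noConst (tailAlg x))
    (hi : ∀ j : Fin n, (j : ℕ) + 1 = m ∨ (m : ℕ) + 1 = j → i j ≠ i m) :
    corner e (List.ofFn fun j => NCPoly.eval (x (i j)) (p j)).prod =
      corner e (List.ofFn fun j => if j = m then corner e (NCPoly.eval (x (i j)) (p j))
        else NCPoly.eval (x (i j)) (p j)).prod := by
  set l := List.ofFn fun j => NCPoly.eval (x (i j)) (p j) with hl
  have hlen : l.length = n := List.length_ofFn
  have hm : (m : ℕ) < l.length := by rw [hlen]; exact m.2
  have hget : ∀ (k : ℕ) (hk : k < l.length), l[k] =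
      NCPoly.eval (x (i ⟨k, hlen ▸ hk⟩)) (p ⟨k, hlen ▸ hk⟩) := by
    intro k hk
    simp [hl]
  have h1 : (List.ofFn fun j => if j = m then corner e (NCPoly.eval (x (i j)) (p j))
      else NCPoly.eval (x (i j)) (p j)) = l.set m (e * l[(m : ℕ)] * e) := by
    apply List.ext_getElem
    · simp [hlen]
    · intro k hk hk'
      rw [List.getElem_set]
      by_cases hkm : (m : ℕ) = k
      · subst hkm
        simp [hget, corner_apply]
      · rw [if_neg hkm, hget]
        rw [List.getElem_ofFn, if_neg]
        intro h
        exact hkm (congrArg Fin.val h).symm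
  rw [h1, corner_apply, corner_apply, mul_prod_set_mul he.idem hm]
  -- The last factor before position `m` has index `m - 1`; there is none when `m = 0`.
  · intro a ha
    rw [List.getLast?_eq_getElem?, List.getElem?_take] at ha
    simp only [List.length_take] at ha
    rw [Nat.min_eq_left hm.le] at ha
    split_ifs at ha with h
    · rw [Option.mem_def, List.getElem?_eq_some_iff] at ha
      obtain ⟨hk, rfl⟩ := ha
      rw [hget, hget]
      exact he.eval_mul_eval (hi _ (Or.inl (by simp; omega))) (hp _) (hp _)
    · simp at ha
  · intro b hb
    rw [List.head?_drop, Option.mem_def, List.getElem?_eq_some_iff] at hb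
    obtain ⟨hk, rfl⟩ := hb
    rw [hget, hget]
    exact he.eval_mul_eval (hi _ (Or.inr rfl)).symm (hp _) (hp _)

end IsTailProjection

end CondExp

end BoolDeFinetti
-- The final assembly.
open BoolDeFinetti in
theorem proposition7p1 {H : Type*} [NormedAddCommGroup H] [InnerProductSpace ℂ H]
    [CompleteSpace H] (A : VonNeumannAlgebra H) (φ : A.toStarSubalgebra →ₗ[ℂ] ℂ)
    (hφ : IsNormalState φ) (hnd : NonDegenerated φ)
    (x : ℕ → A.toStarSubalgebra) (hx : ∀ i, IsSelfAdjoint (x i))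
    (hgen : wotAlg (Set.range x) = ⊤) (hinv : BooleanInvariant φ x) :
    ∃ E : A.toStarSubalgebra →ₗ[ℂ] A.toStarSubalgebra,
      IsNormalCondExp φ (tailAlg x) E ∧
      (∀ E', IsNormalCondExp φ (tailAlg x) E' → E' = E) ∧
      (∀ w : List ℕ, w ≠ [] →
        Filter.Tendsto (fun N : ℕ => toWOT A (w.map fun i => x (i + N)).prod) Filter.atTop
          (𝓝 (toWOT A (E (w.map x).prod)))) ∧
      ∀ (n : ℕ) (p : Fin n → NCPoly (tailAlg x)) (i : Fin n → ℕ) (m : Fin n),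
        (∀ j, p j ∈ NCPoly.noConst (tailAlg x)) →
        (∀ j : Fin n, (j : ℕ) + 1 = m ∨ (m : ℕ) + 1 = j → i j ≠ i m) →
        E (List.ofFn fun j => NCPoly.eval (x (i j)) (p j)).prod =
          E (List.ofFn fun j => if j = m then E (NCPoly.eval (x (i j)) (p j))
            else NCPoly.eval (x (i j)) (p j)).prod := by

  have := isClosed_toStarSubalgebra A
  obtain ⟨K, _, _, _, π, Ω, hG⟩ := exists_isGNS φ hφ.nonneg
  have hS : IsBooleanSystem φ x π Ω := ⟨hG, hG.injective hnd, hφ.normal, hx, hgen, hinv⟩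
  obtain ⟨e, he⟩ := hS.exists_isTailProjection
  refine ⟨corner e, he.isNormalCondExp, fun E' hE' => he.eq_corner hnd hE', fun w hw => ?_,
    fun n p i m hp hi => he.corner_prod_eq hp hi⟩
  have h : ∀ N, (w.map fun i => x (i + N)).prod = word x (shift w N) := fun N => by
    simp [word, shift, Function.comp_def]
  simp_rw [h]
  exact he.tendsto w hw
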